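/- Conventions. A polytope is the convex hull of a finite nonempty set of points in some Euclidean space $\mathbb R^n$. A face of a polytope $P$ is a nonempty subset of the form $F=\{x\in P\mid \ell(x)=c\}$, where $\ell$ is a linear form and $c\in\mathbb R$ is such that $\ell(x)\ge c$ for all $x\in P$ (so $P$ is a face of itself, and faces are again polytopes); the face poset of $P$ is the set of its faces ordered by inclusion, regarded as a category. A polyhedral homeomorphism $P\to Q$ between polytopes is a homeomorphism under which the faces of $P$ correspond exactly to the faces of $Q$. A polyhedral CW complex is a Hausdorff space $K$ together with a family $\{\alpha: P_\alpha\to K\}_{\alpha\in I}$ of continuous maps, each $P_\alpha$ being a polytope with relative interior $\operatorname{int}P_\alpha$, such that (PC0) for every $\alpha\in I$ the restriction of $\alpha$ to $\operatorname{int}P_\alpha$ is a homeomorphism onto its image; (PC1) $K$ is the disjoint union of the sets $\alpha(\operatorname{int}P_\alpha)$, $\alpha\in I$; (PC2) a subset $A\subseteq K$ is closed in $K$ if and only if $A\cap\alpha(P_\alpha)$ is closed for every $\alpha\in I$; (PC3) for every $\alpha\in I$ and every face $F$ of $P_\alpha$ there are $\beta\in I$ and a polyhedral homeomorphism $\phi:P_\beta\to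 F$ with $\beta=\alpha\circ\phi$. The face category of $K$ has object set $I$; the morphisms from $\beta$ to $\alpha$ are the polyhedral homeomorphisms $\phi$ of $P_\beta$ onto a face of $P_\alpha$ such that $\beta=\alpha\circ\phi$; composition is composition of maps. An acyclic category is a small category in which the only endomorphisms are the identities and the only invertible morphisms are endomorphisms. For an object $x$ of a category $\mathscr C$, the slice $\mathscr C/x$ is the category whose objects are the morphisms of $\mathscr C$ with target $x$, and in which a morphism from $\phi:a\to x$ to $\psi:b\to x$ is a morphism $\zeta:a\to b$ with $\psi\circ\zeta=\phi$. Isomorphism of categories means the existence of mutually inverse functors. Theorem. Let $\mathscr C$ be an acyclic category. Then $\mathscr C$ is isomorphic to the face category of a polyhedral CW complex if and only if for every object $x$ of $\mathscr C$ the slice $\mathscr C/x$ is isomorphic to the face poset of a polytope. -/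

import Mathlib

open CategoryTheory

universe u v

section Polytopes

variable {E E' E'' : Type*} [NormedAddCommGroup E] [NormedSpace ℝ E]
  [NormedAddCommGroup E'] [NormedSpace ℝ E'] [NormedAddCommGroup E''] [NormedSpace ℝ E'']

/-- A (nonempty) polytope: the convex hull of a finite nonempty set of points. -/
def IsPolytope (P : Set E) : Prop :=
  ∃ s : Finset E, s.Nonempty ∧ P = convexHull ℝ (s : Set E)

/-- A face of `P`: a nonempty subset of the form `{x ∈ P | ℓ x = c}`, where `ℓ` is a linear form
whose extreme value on `P` is `c` (in particular `P` itself, for `ℓ = 0`). -/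
def IsFace (P F : Set E) : Prop :=
  F.Nonempty ∧ IsExposed ℝ P F

/-- The poset of faces of `P`, ordered by inclusion. As for every preorder, Mathlib turns it into
a category with exactly one morphism `F ⟶ G` if `F ≤ G`, and none otherwise. -/
abbrev FacePoset (P : Set E) : Type _ := {F : Set E // IsFace P F}

/-- A polyhedral homeomorphism: a homeomorphism `P ≃ₜ Q` under which the faces of `P` correspond
exactly to the faces of `Q`. -/
def IsPolyhedralHomeo {P : Set E} {Q : Set E'} (f : P ≃ₜ Q) : Prop :=
  ∀ S : Set P, IsFace P ((↑) '' S) ↔ IsFace Q ((↑) '' (f '' S))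

/-- A map `P → Q` that is a polyhedral homeomorphism `φ` of `P` onto a face `F` of `Q`
(followed by the inclusion of `F` in `Q`). -/
def IsFaceMap {P : Set E} {Q : Set E'} (f : P → Q) : Prop :=
  ∃ F : Set E', IsFace Q F ∧
    ∃ φ : P ≃ₜ F, IsPolyhedralHomeo φ ∧ ∀ x : P, (f x : E') = (φ x : E')

lemma IsFace.subset {P F : Set E} (h : IsFace P F) : F ⊆ P := h.2.subset

lemma IsFace.refl {P : Set E} (h : P.Nonempty) : IsFace P P := ⟨h, IsExposed.refl P⟩

lemma IsFace.mono {P F G : Set E} (h : IsFace P G) (hFP : F ⊆ P) (hGF : G ⊆ F) : IsFace F G :=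
  ⟨h.1, h.2.mono hFP hGF⟩

lemma IsPolytope.nonempty {P : Set E} (h : IsPolytope P) : P.Nonempty := by
  obtain ⟨s, hs, rfl⟩ := h
  exact (Finset.coe_nonempty.mpr hs).convexHull

/-- A face of a face of a polytope is a face of the polytope. -/
lemma IsFace.trans {P F G : Set E} (hP : IsPolytope P) (hF : IsFace P F) (hG : IsFace F G) :
    IsFace P G := by
  refine ⟨hG.1, fun _ => ?_⟩
  obtain ⟨l, hl⟩ := hF.2 hF.1
  obtain ⟨m, hm⟩ := hG.2 hG.1
  obtain ⟨g, hg⟩ := hG.1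
  obtain ⟨s, -, rfl⟩ := hP
  have hgF : g ∈ F := hG.subset hg
  have hgP := hF.subset hgF
  have hlg : ∀ y ∈ convexHull ℝ (s : Set E), l y ≤ l g := by
    rw [hl] at hgF; exact hgF.2
  have hmg : ∀ y ∈ F, m y ≤ m g := by
    rw [hm] at hg; exact hg.2
  have memF : ∀ x ∈ convexHull ℝ (s : Set E), l x = l g → x ∈ F := by
    intro x hx hxl
    rw [hl]
    exact ⟨hx, fun y hy => hxl ▸ hlg y hy⟩
  set N : ℝ := ∑ v ∈ s, |m v - m g| / (l g - l v) with hN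
  have hvN : ∀ v ∈ s, N * l v + m v ≤ N * l g + m g := by
    intro v hv
    have hvP : v ∈ convexHull ℝ (s : Set E) := subset_convexHull ℝ _ hv
    have h1 := hlg v hvP
    rcases h1.eq_or_lt with h | h
    · rw [h]
      linarith [hmg v (memF v hvP h)]
    · have h2 : |m v - m g| / (l g - l v) ≤ N :=
        Finset.single_le_sum (f := fun v => |m v - m g| / (l g - l v))
          (fun w hw => div_nonneg (abs_nonneg _)
            (sub_nonneg.mpr (hlg w (subset_convexHull ℝ _ hw)))) hv
      rw [div_le_iff₀ (sub_pos.mpr h)] at h2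
      nlinarith [le_abs_self (m v - m g)]
  have hxN : ∀ x ∈ convexHull ℝ (s : Set E), N * l x + m x ≤ N * l g + m g := by
    have hc : Convex ℝ {x : E | (N • l + m) x ≤ N * l g + m g} :=
      convex_halfSpace_le (N • l + m).isLinear _
    have := convexHull_min (s := (s : Set E)) (fun v hv => by simpa using hvN v hv) hc
    intro x hx
    simpa using this hx
  refine ⟨(N + 1) • l + m, Set.Subset.antisymm (fun x hx => ?_) (fun x hx => ?_)⟩
  · have hxF := hG.subset hx
    have hxP := hF.subset hxF
    refine ⟨hxP, fun y hy => ?_⟩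
    have e1 : l g ≤ l x := by
      rw [hl] at hxF; exact hxF.2 g hgP
    have e2 : m g ≤ m x := by
      rw [hm] at hx; exact hx.2 g hgF
    have e3 : l x = l g := le_antisymm (hlg x hxP) e1
    have h1 := hxN y hy
    have h2 := hlg y hy
    simp only [add_apply, smul_apply, smul_eq_mul, e3]
    linarith
  · have h0 := hx.2 g hgP
    simp only [add_apply, smul_apply, smul_eq_mul] at h0
    have h1 := hxN x hx.1
    have h2 := hlg x hx.1
    have e1 : l x = l g := by linarith
    have hxF := memF x hx.1 e1
    have e2 : m g ≤ m x := by rw [e1] at h0; linarith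
    rw [hm]
    exact ⟨hxF, fun y hy => (hmg y hy).trans e2⟩

lemma IsFaceMap.id {P : Set E} (hP : P.Nonempty) : IsFaceMap (fun x : P => x) :=
  ⟨P, IsFace.refl hP, Homeomorph.refl P, fun S => by simp, fun _ => rfl⟩

lemma IsFaceMap.comp {P : Set E} {Q : Set E'} {R : Set E''} {f : P → Q} {g : Q → R}
    (hQ : IsPolytope Q) (hR : IsPolytope R) (hg : IsFaceMap g) (hf : IsFaceMap f) :
    IsFaceMap (fun x => g (f x)) := by
  obtain ⟨F, hF, φ, hφ, hfφ⟩ := hf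
  obtain ⟨G, hG, ψ, hψ, hgψ⟩ := hg
  -- the image of the composite
  set H : Set E'' := (↑) '' (ψ '' ((↑) ⁻¹' F : Set Q)) with hH
  have hFimg : ((↑) '' ((↑) ⁻¹' F : Set Q) : Set E') = F := by
    rw [Subtype.image_preimage_coe, Set.inter_eq_right]
    exact hF.subset
  have hHG : IsFace G H := (hψ _).1 (by rw [hFimg]; exact hF)
  have hHR : IsFace R H := hG.trans hR hHG
  let ι : F → Q := fun x => ⟨x.1, hF.subset x.2⟩
  have hmem : ∀ x : F, ((ψ (ι x) : G) : E'') ∈ H := fun x =>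
    ⟨ψ (ι x), ⟨ι x, x.2, rfl⟩, rfl⟩
  have hmem' : ∀ y : H, ((ψ.symm ⟨y.1, hHG.subset y.2⟩ : Q) : E') ∈ F := by
    rintro ⟨y, z, ⟨q, hq, rfl⟩, rfl⟩
    simpa using hq
  let χ : F ≃ₜ H :=
    { toFun := fun x => ⟨ψ (ι x), hmem x⟩
      invFun := fun y => ⟨ψ.symm ⟨y.1, hHG.subset y.2⟩, hmem' y⟩
      left_inv := fun x => by simp [ι]
      right_inv := fun y => by simp [ι]
      continuous_toFun := by fun_prop
      continuous_invFun := by fun_prop }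
  refine ⟨H, hHR, φ.trans χ, fun S => ?_, fun x => ?_⟩
  · rw [hφ S]
    have e1 : ((↑) '' ((φ.trans χ) '' S) : Set E'') =
        (↑) '' (ψ '' (ι '' (φ '' S))) := by
      simp only [Set.image_image]
      rfl
    have e2 : ((↑) '' (φ '' S) : Set E') = (↑) '' (ι '' (φ '' S)) := by
      simp only [Set.image_image]
      rfl
    have s1 : ((↑) '' (φ '' S) : Set E') ⊆ F := by
      rintro _ ⟨y, -, rfl⟩; exact y.2
    have s2 : ((↑) '' ((φ.trans χ) '' S) : Set E'') ⊆ H := by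
      rintro _ ⟨y, -, rfl⟩; exact y.2
    constructor
    · intro h
      have h1 := hF.trans hQ h
      rw [e2] at h1
      have h2 := (hψ _).1 h1
      rw [← e1] at h2
      exact h2.mono hHG.subset s2
    · intro h
      have h1 := (hHR.trans hR h).mono hG.subset (s2.trans hHG.subset)
      rw [e1] at h1
      have h2 := (hψ _).2 h1
      rw [← e2] at h2
      exact h2.mono hF.subset s1
  · have : f x = ι (φ x) := Subtype.ext (hfφ x)
    simp only [this, hgψ]
    rfl

end Polytopes

/-- An acyclic category: the only endomorphisms are the identities and the only invertible
morphisms are endomorphisms. -/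
structure IsAcyclicCategory (C : Type u) [Category.{v} C] : Prop where
  endo_eq_id : ∀ (x : C) (f : x ⟶ x), f = 𝟙 x
  eq_of_isIso : ∀ (x y : C) (f : x ⟶ y), IsIso f → x = y

/-- The structure of a polyhedral CW complex on a Hausdorff space `K`: a family of continuous
maps `map i : P_i → K`, where `P_i = cell i` is a polytope in a Euclidean space, subject to the
conditions below. -/
structure PolyhedralCWComplex (K : Type u) [TopologicalSpace K] [T2Space K] where
  /-- The index set of the family. -/
  Index : Type u
  /-- The dimension of the Euclidean space in which `P_i` lies. -/
  dim : Index → ℕ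
  /-- The polytope `P_i`. -/
  cell : (i : Index) → Set (EuclideanSpace ℝ (Fin (dim i)))
  isPolytope : ∀ i, IsPolytope (cell i)
  /-- The map `P_i → K`. -/
  map : (i : Index) → cell i → K
  continuous_map : ∀ i, Continuous (map i)
  /-- The restriction of `map i` to the relative interior of `P_i` is a homeomorphism onto its
  image. -/
  isEmbedding_interior : ∀ i, Topology.IsEmbedding
    (fun x : {x : cell i // (x : EuclideanSpace ℝ (Fin (dim i))) ∈
      intrinsicInterior ℝ (cell i)} => map i x.1)
  /-- `K` is the disjoint union of the images of the relative interiors of the `P_i`. -/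
  existsUnique_mem : ∀ p : K, ∃! i, p ∈ map i '' {x : cell i |
    (x : EuclideanSpace ℝ (Fin (dim i))) ∈ intrinsicInterior ℝ (cell i)}
  /-- A subset is closed if and only if its intersection with every `map i (P_i)` is closed. -/
  isClosed_iff : ∀ A : Set K, IsClosed A ↔ ∀ i, IsClosed (A ∩ Set.range (map i))
  /-- For every face `F` of every `P_i` there are `j` and a polyhedral homeomorphism
  `φ : P_j → F` such that `map j = map i ∘ φ`. -/
  exists_face : ∀ (i : Index) (F : Set (EuclideanSpace ℝ (Fin (dim i)))) (hF : IsFace (cell i) F),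
    ∃ (j : Index) (φ : cell j ≃ₜ F), IsPolyhedralHomeo φ ∧
      ∀ x : cell j, map j x = map i ⟨(φ x : EuclideanSpace ℝ (Fin (dim i))), hF.subset (φ x).2⟩

namespace PolyhedralCWComplex

variable {K : Type u} [TopologicalSpace K] [T2Space K]

/-- The objects of the face category of a polyhedral CW complex: the indices of its cells. -/
structure FaceCategory (X : PolyhedralCWComplex K) : Type u where
  index : X.Index

/-- The face category. A morphism from `j` to `i` is a polyhedral homeomorphism `φ` of `P_j`
onto a face of `P_i` (regarded as a map into `P_i`) with `map i ∘ φ = map j`. Composition is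
composition of maps. -/
instance (X : PolyhedralCWComplex K) : Category.{0} X.FaceCategory where
  Hom j i := {φ : X.cell j.index → X.cell i.index //
    IsFaceMap φ ∧ ∀ x, X.map i.index (φ x) = X.map j.index x}
  id i := ⟨fun x => x, IsFaceMap.id (X.isPolytope i.index).nonempty, fun _ => rfl⟩
  comp {_ i k} φ ψ := ⟨fun x => ψ.1 (φ.1 x),
    IsFaceMap.comp (X.isPolytope i.index) (X.isPolytope k.index) ψ.2.1 φ.2.1,
    fun x => (ψ.2.2 (φ.1 x)).trans (φ.2.2 x)⟩

end PolyhedralCWComplex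

/-! The substantial direction glues polytopes P_x whose face posets are the slices. Faces of the
same combinatorial type need not be affinely equivalent, so the gluing maps are piecewise linear on
barycentric subdivisions: by `IsPolytope.exists_coordinates`, a point of P_x amounts to a convex
weight on the slice over x supported on a chain. A morphism f : y ⟶ x embeds the slice over y as the
part of the slice over x below f (`CellSystem.postcomp_injective`). Extending weights by zero then
gives a map of P_y onto a face of P_x that is strictly functorial (`CellSystem.faceMap_comp`) and
matches faces (`CellSystem.isPolyhedralHomeo_faceHomeo`).

Every point of P_x lies in the relative interior of exactly one face, so the glued space is the
disjoint union of the relative interiors. It is Hausdorff because the functions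
`CellSystem.edgeFun`, which respect the gluing, separate its points. Its face category is no larger
than the given one: a homeomorphism between cells that commutes with the characteristic maps fixes
the dense interior (`CellSystem.homeo_eq_id`).

Conversely, in a face category a morphism into i is sent to its image, a face of P_i. Face maps with
nested images factor through one another (`IsFaceMap.exists_factor`), acyclicity makes the image
determine the morphism, and (PC3) realizes every face. -/

/-! ### Faces and relative interiors of polytopes. -/

section PolytopeGeometry

variable {E : Type*} [NormedAddCommGroup E] [NormedSpace ℝ E]

lemma IsPolytope.convex {P : Set E} (h : IsPolytope P) : Convex ℝ P := by
  obtain ⟨s, -, rfl⟩ := h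
  exact convex_convexHull ℝ _

lemma IsPolytope.isCompact {P : Set E} (h : IsPolytope P) : IsCompact P := by
  obtain ⟨s, -, rfl⟩ := h
  exact s.finite_toSet.isCompact_convexHull ℝ

/-- The set of points of `P` that lie in no proper face. -/
def polytopeCore (P : Set E) : Set E :=
  {p | p ∈ P ∧ ∀ F, IsFace P F → p ∈ F → F = P}

lemma IsFace.exists_le {P F : Set E} (h : IsFace P F) :
    ∃ (l : StrongDual ℝ E) (M : ℝ), (∀ x ∈ P, l x ≤ M) ∧ ∀ x ∈ P, x ∈ F ↔ l x = M := by
  obtain ⟨l, hl⟩ := h.2 h.1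
  obtain ⟨g, hg⟩ := h.1
  have hg' := hg
  rw [hl] at hg'
  refine ⟨l, l g, hg'.2, fun x hx => ?_⟩
  rw [hl]
  exact ⟨fun hx' => le_antisymm (hg'.2 x hx) (hx'.2 g hg'.1),
    fun e => ⟨hx, fun y hy => e ▸ hg'.2 y hy⟩⟩

lemma IsFace.of_le {P : Set E} (l : StrongDual ℝ E) {p : E} (hp : p ∈ P)
    (h : ∀ x ∈ P, l x ≤ l p) : IsFace P {x ∈ P | l x = l p} := by
  refine ⟨⟨p, hp, rfl⟩, fun _ => ⟨l, Set.ext fun x => ?_⟩⟩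
  exact ⟨fun hx => ⟨hx.1, fun y hy => hx.2 ▸ h y hy⟩,
    fun hx => ⟨hx.1, le_antisymm (h x hx.1) (hx.2 p hp)⟩⟩

lemma IsFace.inter {P F G : Set E} (hF : IsFace P F) (hG : IsFace P G) (h : (F ∩ G).Nonempty) :
    IsFace P (F ∩ G) :=
  ⟨h, hF.2.inter hG.2⟩

/-- If a weighted mean of points of `P` lies in a face, so do the points of nonzero weight. -/
lemma IsFace.mem_of_sum_smul_eq {P F : Set E} (hF : IsFace P F) {ι : Type*} {s : Finset ι}
    {w : ι → ℝ} {z : ι → E} (hw : ∀ i ∈ s, 0 ≤ w i) (hz : ∀ i ∈ s, z i ∈ P) {y : E} (hy : y ∈ F)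
    (h : ∑ i ∈ s, w i • z i = (∑ i ∈ s, w i) • y) {i : ι} (hi : i ∈ s) (hwi : w i ≠ 0) :
    z i ∈ F := by
  obtain ⟨l, M, hM, hl⟩ := hF.exists_le
  have hly : l y = M := (hl y (hF.subset hy)).1 hy
  have hnn : ∀ j ∈ s, 0 ≤ w j * (M - l (z j)) := fun j hj =>
    mul_nonneg (hw j hj) (sub_nonneg.2 (hM _ (hz j hj)))
  have hsum : ∑ j ∈ s, w j * (M - l (z j)) = 0 := by
    have := congrArg l h
    simp only [map_sum, map_smul, smul_eq_mul, hly] at this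
    simp only [mul_sub, Finset.sum_sub_distrib, ← Finset.sum_mul, this, sub_self]
  have h0 := (Finset.sum_eq_zero_iff_of_nonneg hnn).1 hsum i hi
  rw [hl _ (hz i hi)]
  linarith [(mul_eq_zero.1 h0).resolve_left hwi]

lemma IsFace.eq_convexHull {s : Finset E} {F : Set E} (hF : IsFace (convexHull ℝ (s : Set E)) F) :
    F = convexHull ℝ ((s : Set E) ∩ F) := by
  classical
  apply Set.Subset.antisymm
  · intro x hx
    obtain ⟨w, w0, w1, hw⟩ := Finset.mem_convexHull.1 (hF.subset hx)
    rw [s.centerMass_eq_of_sum_1 _ w1] at hw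
    have hz : ∀ v ∈ s, w v ≠ 0 → v ∈ F := fun v hv =>
      hF.mem_of_sum_smul_eq (z := id) w0 (fun v hv => subset_convexHull ℝ _ hv) hx
        (by rw [w1, one_smul, hw]) hv
    rw [← hw, ← Finset.sum_filter_of_ne (p := (· ∈ F))
      fun v hv h => hz v hv fun h0 => h (by simp [h0])]
    refine (convex_convexHull ℝ _).sum_mem (fun v hv => w0 v (Finset.mem_filter.1 hv).1) ?_
      fun v hv => subset_convexHull ℝ _ (by simpa using hv)
    rw [Finset.sum_filter_of_ne fun v hv h => hz v hv h, w1]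
  · exact convexHull_min Set.inter_subset_right (hF.2.convex (convex_convexHull ℝ _))

lemma IsFace.isPolytope {P F : Set E} (hP : IsPolytope P) (hF : IsFace P F) : IsPolytope F := by
  classical
  obtain ⟨s, hs, rfl⟩ := hP
  have h := hF.eq_convexHull
  refine ⟨s.filter (· ∈ F), ?_, ?_⟩
  · rw [← Finset.coe_nonempty, ← convexHull_nonempty_iff (𝕜 := ℝ)]
    have : ((s.filter (· ∈ F) : Finset E) : Set E) = (s : Set E) ∩ F := by ext; simp
    rw [this, ← h]; exact hF.1
  · have : ((s.filter (· ∈ F) : Finset E) : Set E) = (s : Set E) ∩ F := by ext; simp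
    rw [this, ← h]

lemma IsPolytope.finite_facePoset {P : Set E} (hP : IsPolytope P) : Finite (FacePoset P) := by
  obtain ⟨s, hs, rfl⟩ := hP
  have : Finite {t : Set E // t ⊆ (s : Set E)} := (s.finite_toSet.finite_subsets).to_subtype
  refine Finite.of_injective (β := {t : Set E // t ⊆ (s : Set E)})
    (fun F => ⟨(s : Set E) ∩ F.1, Set.inter_subset_left⟩) fun F G h => ?_
  have h' : (s : Set E) ∩ F.1 = (s : Set E) ∩ G.1 := congrArg Subtype.val h
  exact Subtype.ext (by rw [F.2.eq_convexHull, h', ← G.2.eq_convexHull])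

/-- The mean of the generators gives each of them positive weight, so a face through it contains
them all. -/
lemma IsPolytope.polytopeCore_nonempty {P : Set E} (hP : IsPolytope P) :
    (polytopeCore P).Nonempty := by
  obtain ⟨s, hs, rfl⟩ := hP
  have hc : (0 : ℝ) < s.card := by exact_mod_cast hs.card_pos
  have h1 : ∑ v ∈ s, (s.card : ℝ)⁻¹ = 1 := by simp [hc.ne']
  refine ⟨∑ v ∈ s, (s.card : ℝ)⁻¹ • v, (convex_convexHull ℝ _).sum_mem (fun _ _ => by positivity)
    h1 fun v hv => subset_convexHull ℝ _ hv, fun F hF hpF => ?_⟩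
  refine Set.Subset.antisymm hF.subset
    (convexHull_min (fun v hv => ?_) (hF.2.convex (convex_convexHull ℝ _)))
  exact hF.mem_of_sum_smul_eq (z := id) (w := fun _ => (s.card : ℝ)⁻¹) (fun _ _ => by positivity)
    (fun v hv => subset_convexHull ℝ _ hv) hpF (by rw [h1, one_smul]; rfl) hv (by positivity)

/-- F ∩ G is a face of F through a point that lies in no proper face of F. -/
lemma subset_of_mem_polytopeCore {P F G : Set E} (hF : IsFace P F) (hG : IsFace P G) {p : E}
    (hpF : p ∈ polytopeCore F) (hpG : p ∈ G) : F ⊆ G := by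
  have h := hF.inter hG ⟨p, hpF.1, hpG⟩
  have := hpF.2 _ (h.mono hF.subset Set.inter_subset_left) ⟨hpF.1, hpG⟩
  rw [← this]
  exact Set.inter_subset_right

lemma exists_add_smul_mem_of_mem_intrinsicInterior {P : Set E} {p x : E}
    (hp : p ∈ intrinsicInterior ℝ P) (hx : x ∈ P) : ∃ ε > (0 : ℝ), p + ε • (p - x) ∈ P := by
  obtain ⟨p', hp', rfl⟩ := hp
  have hmem : ∀ t : ℝ, (p' : E) + t • ((p' : E) - x) ∈ affineSpan ℝ P := fun t => by
    have := AffineMap.lineMap_mem (-t) p'.2 (subset_affineSpan ℝ P hx)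
    convert this using 1
    rw [AffineMap.lineMap_apply_module']
    module
  let γ : ℝ → affineSpan ℝ P := fun t => ⟨_, hmem t⟩
  have hγ : Continuous γ := by fun_prop
  have hγ0 : γ 0 = p' := Subtype.ext (by simp [γ])
  have h1 : ∀ᶠ t in nhds (0 : ℝ), γ t ∈ interior ((↑) ⁻¹' P : Set (affineSpan ℝ P)) :=
    hγ.continuousAt.eventually (by rw [hγ0]; exact isOpen_interior.mem_nhds hp')
  obtain ⟨ε, hε, h⟩ := Metric.eventually_nhds_iff.1 h1
  have h2 : γ (ε / 2) ∈ interior ((↑) ⁻¹' P : Set (affineSpan ℝ P)) :=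
    h (by rw [Real.dist_0_eq_abs, abs_of_pos (half_pos hε)]; exact half_lt_self hε)
  exact ⟨ε / 2, half_pos hε, (interior_subset h2 : _)⟩

/-- Faces are extreme, so a face meeting the open segment from a core point b to p contains b; the
whole open segment therefore lies in the core. -/
lemma IsPolytope.subset_closure_polytopeCore {P : Set E} (hP : IsPolytope P) :
    P ⊆ closure (polytopeCore P) := by
  intro p hp
  obtain ⟨b, hb⟩ := hP.polytopeCore_nonempty
  have h : openSegment ℝ b p ⊆ polytopeCore P := fun q hq =>
    ⟨hP.convex.openSegment_subset hb.1 hp hq, fun F hF hqF =>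
      hb.2 F hF (hF.2.isExtreme.left_mem_of_mem_openSegment hb.1 hp hqF hq)⟩
  exact closure_mono h (segment_subset_closure_openSegment (right_mem_segment ℝ b p))

section FiniteDimensional

variable [FiniteDimensional ℝ E]

/-- In the direction space of the affine span, with p moved to 0, the relative interior becomes an
interior. Hahn–Banach gives a supporting form there, which is then extended to E. -/
lemma Convex.exists_isFace_ne {P : Set E} (hP : Convex ℝ P) {p : E} (hp : p ∈ P)
    (h : p ∉ intrinsicInterior ℝ P) : ∃ F, IsFace P F ∧ p ∈ F ∧ F ≠ P := by
  have : Nonempty P := ⟨⟨p, hp⟩⟩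
  let p' : affineSpan ℝ P := ⟨p, subset_affineSpan _ _ hp⟩
  let φ := (AffineIsometryEquiv.vaddConst ℝ p').toHomeomorph
  have hφ : ∀ v, ((φ v : affineSpan ℝ P) : E) = (v : E) + p := fun v => rfl
  set A : Set (affineSpan ℝ P).direction := φ ⁻¹' ((↑) ⁻¹' P) with hA
  have hAc : Convex ℝ A := hP.affine_preimage
    ((affineSpan ℝ P).subtype.comp (AffineIsometryEquiv.vaddConst ℝ p').toAffineEquiv.toAffineMap)
  have hAi : interior A = φ ⁻¹' interior ((↑) ⁻¹' P) := (φ.preimage_interior _).symm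
  have hAne : (interior A).Nonempty := by
    obtain ⟨-, y, hy, rfl⟩ := Set.Nonempty.intrinsicInterior hP ⟨p, hp⟩
    exact ⟨φ.symm y, by rw [hAi]; simpa using hy⟩
  have h0 : (0 : (affineSpan ℝ P).direction) ∉ interior A := by
    rw [hAi]
    intro h0
    exact h ⟨φ 0, h0, by simp [hφ]⟩
  obtain ⟨f, hf0, hf⟩ := geometric_hahn_banach_of_nonempty_interior_point hAc h0 hAne
  obtain ⟨g, hg, -⟩ := exists_extension_norm_eq _ f
  have hsub : ∀ x ∈ P, ∃ v ∈ A, g x = g p + f v := by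
    intro x hx
    refine ⟨φ.symm ⟨x, subset_affineSpan _ _ hx⟩, by simpa [hA] using hx, ?_⟩
    rw [← hg, ← map_add, add_comm, ← hφ]
    simp
  refine ⟨_, IsFace.of_le g hp fun x hx => ?_, ⟨hp, rfl⟩, fun hF => hf0 ?_⟩
  · obtain ⟨v, hv, e⟩ := hsub x hx
    have := hf v hv
    rw [map_zero] at this
    linarith
  -- If the face were all of P, f would vanish on A, which has interior points, so f would be zero.
  · have hk : LinearMap.ker f.toLinearMap = ⊤ := by
      apply Submodule.eq_top_of_nonempty_interior'
      refine hAne.mono (interior_mono fun v hv => ?_)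
      have hvP : (v : E) + p ∈ P := hv
      have h2 := (hF.symm.subset hvP).2
      rw [map_add, hg] at h2
      change f v = 0
      linarith
    ext v
    have : v ∈ LinearMap.ker f.toLinearMap := hk ▸ Submodule.mem_top
    exact this

/-- This makes the relative interior combinatorial. A form maximal at a relative interior point is
constant on P, since P continues a little beyond that point in the direction away from any x. -/
lemma intrinsicInterior_eq_polytopeCore {P : Set E} (hP : Convex ℝ P) :
    intrinsicInterior ℝ P = polytopeCore P := by
  ext p
  constructor
  · intro hp
    refine ⟨intrinsicInterior_subset hp, fun F hF hpF => Set.Subset.antisymm hF.subset ?_⟩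
    intro x hx
    obtain ⟨l, M, hM, hl⟩ := hF.exists_le
    obtain ⟨ε, hε, h⟩ := exists_add_smul_mem_of_mem_intrinsicInterior hp hx
    have h1 := hM _ h
    have h2 := hM x hx
    have h3 := (hl p (hF.subset hpF)).1 hpF
    simp only [map_add, map_smul, map_sub, smul_eq_mul] at h1
    refine (hl x hx).2 (le_antisymm h2 ?_)
    have : ε * (l p - l x) ≤ 0 := by linarith
    nlinarith
  · intro hp
    by_contra h
    obtain ⟨F, hF, hpF, hne⟩ := hP.exists_isFace_ne hp.1 h
    exact hne (hp.2 F hF hpF)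

/-- The ray from a point `b` of a polytope through another one leaves it in the boundary. -/
lemma IsPolytope.exists_mem_segment_notMem_polytopeCore {P : Set E} (hP : IsPolytope P) {b p : E}
    (hb : b ∈ P) (hp : p ∈ P) (hne : p ≠ b) :
    ∃ q ∈ P, q ∉ polytopeCore P ∧ ∃ t ∈ Set.Icc (0 : ℝ) 1, p = (1 - t) • b + t • q := by
  set T : Set ℝ := {t | b + t • (p - b) ∈ P}
  have hTc : IsClosed T := hP.isCompact.isClosed.preimage (by fun_prop)
  have hd : 0 < ‖p - b‖ := norm_pos_iff.2 (sub_ne_zero.2 hne)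
  have hTb : BddAbove T := by
    obtain ⟨R, hR⟩ := hP.isCompact.isBounded.exists_norm_le
    refine ⟨(R + ‖b‖) / ‖p - b‖, fun t ht => ?_⟩
    rw [le_div_iff₀ hd]
    calc t * ‖p - b‖ ≤ ‖t • (p - b)‖ := by
          rw [norm_smul]; exact mul_le_mul_of_nonneg_right (le_abs_self t) hd.le
      _ = ‖(b + t • (p - b)) - b‖ := by rw [add_sub_cancel_left]
      _ ≤ ‖b + t • (p - b)‖ + ‖b‖ := norm_sub_le _ _
      _ ≤ R + ‖b‖ := by gcongr; exact hR _ ht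
  have h1T : (1 : ℝ) ∈ T := by simpa [T] using hp
  set t := sSup T
  have htT : t ∈ T := hTc.csSup_mem ⟨1, h1T⟩ hTb
  have ht1 : 1 ≤ t := le_csSup hTb h1T
  have ht0 : 0 < t := by linarith
  refine ⟨b + t • (p - b), htT, fun hc => ?_, t⁻¹, ⟨by positivity, inv_le_one_of_one_le₀ ht1⟩, ?_⟩
  -- A relative interior exit point would let the ray continue to parameter t + εt, beyond the
  -- supremum.
  · rw [← intrinsicInterior_eq_polytopeCore hP.convex] at hc
    obtain ⟨ε, hε, h⟩ := exists_add_smul_mem_of_mem_intrinsicInterior hc hb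
    have : t + ε * t ∈ T := by
      change _ ∈ P
      convert h using 1
      module
    have := le_csSup hTb this
    nlinarith
  · rw [smul_add, smul_smul, inv_mul_cancel₀ ht0.ne']
    module

end FiniteDimensional

end PolytopeGeometry

/-! ### Points of a polytope as weights on chains of faces. -/

section BarycentricCoordinates

variable {E : Type*} [NormedAddCommGroup E] [NormedSpace ℝ E] {P : Set E}

/-- A chosen point of a face that lies in no proper face of it. -/
noncomputable def IsPolytope.faceCenter (hP : IsPolytope P) (F : FacePoset P) : E :=
  (F.2.isPolytope hP).polytopeCore_nonempty.some

lemma IsPolytope.faceCenter_mem_polytopeCore (hP : IsPolytope P) (F : FacePoset P) :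
    hP.faceCenter F ∈ polytopeCore F.1 :=
  (F.2.isPolytope hP).polytopeCore_nonempty.some_mem

lemma IsPolytope.faceCenter_mem (hP : IsPolytope P) (F : FacePoset P) : hP.faceCenter F ∈ F.1 :=
  (hP.faceCenter_mem_polytopeCore F).1

lemma IsPolytope.faceCenter_mem_of_le (hP : IsPolytope P) {F G : FacePoset P} (h : F ≤ G) :
    hP.faceCenter F ∈ G.1 :=
  h (hP.faceCenter_mem F)

lemma IsPolytope.le_of_faceCenter_mem (hP : IsPolytope P) {F G : FacePoset P}
    (h : hP.faceCenter F ∈ G.1) : F ≤ G :=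
  subset_of_mem_polytopeCore F.2 G.2 (hP.faceCenter_mem_polytopeCore F) h

/-- Nonnegative weights on a preorder, supported on a chain. -/
structure IsChainWeight {L : Type*} [LE L] (w : L → ℝ) : Prop where
  nonneg : ∀ a, 0 ≤ w a
  total : ∀ a b, w a ≠ 0 → w b ≠ 0 → a ≤ b ∨ b ≤ a

lemma IsChainWeight.exists_top {L : Type*} [PartialOrder L] [Finite L] {w : L → ℝ}
    (hw : IsChainWeight w) (h : w ≠ 0) : ∃ a, w a ≠ 0 ∧ ∀ b, w b ≠ 0 → b ≤ a := by
  obtain ⟨a, ha⟩ := Function.ne_iff.1 h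
  obtain ⟨m, hm⟩ := (Set.toFinite {a | w a ≠ 0}).exists_maximal ⟨a, ha⟩
  exact ⟨m, hm.prop, fun b hb => (hw.total b m hb hm.prop).elim id fun h => hm.le_of_ge hb h⟩

variable [Fintype (FacePoset P)]

lemma IsPolytope.sum_smul_faceCenter_mem (hP : IsPolytope P) {w : FacePoset P → ℝ}
    (hw : ∀ F, 0 ≤ w F) {G : FacePoset P} (hG : ∀ F, w F ≠ 0 → F ≤ G) (h1 : ∑ F, w F = 1) :
    ∑ F, w F • hP.faceCenter F ∈ G.1 := by
  classical
  rw [← Finset.sum_filter_of_ne (p := fun F => w F ≠ 0) fun F _ h h0 => h (by simp [h0])]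
  refine (G.2.isPolytope hP).convex.sum_mem (fun F _ => hw F) ?_ fun F hF =>
    hP.faceCenter_mem_of_le (hG F (by simpa using hF))
  rw [Finset.sum_filter_of_ne fun F _ h => h, h1]

lemma IsPolytope.le_of_sum_smul_faceCenter_mem (hP : IsPolytope P) {w : FacePoset P → ℝ}
    (hw : ∀ F, 0 ≤ w F) {G : FacePoset P} {y : E} (hy : y ∈ G.1)
    (h : ∑ F, w F • hP.faceCenter F = (∑ F, w F) • y) {F : FacePoset P} (hF : w F ≠ 0) : F ≤ G :=
  hP.le_of_faceCenter_mem <| G.2.mem_of_sum_smul_eq (fun F _ => hw F)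
    (fun F _ => F.2.subset (hP.faceCenter_mem F)) hy h (Finset.mem_univ F) hF

lemma IsPolytope.chainWeight_support_le (hP : IsPolytope P) {w w' : FacePoset P → ℝ}
    (hw : ∀ F, 0 ≤ w F) (hw' : ∀ F, 0 ≤ w' F) {G : FacePoset P} (hG : ∀ F, w F ≠ 0 → F ≤ G)
    (h1 : ∑ F, w F = ∑ F, w' F)
    (h : ∑ F, w F • hP.faceCenter F = ∑ F, w' F • hP.faceCenter F) :
    ∀ F, w' F ≠ 0 → F ≤ G := by
  intro F hF
  have hpos : 0 < ∑ F, w' F :=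
    lt_of_lt_of_le (lt_of_le_of_ne (hw' F) hF.symm)
      (Finset.single_le_sum (fun F _ => hw' F) (Finset.mem_univ F))
  set T := ∑ F, w' F
  -- Rescaling w to total weight one gives a point y of G; both weighted sums equal T • y.
  refine hP.le_of_sum_smul_faceCenter_mem hw' (y := ∑ F, (T⁻¹ * w F) • hP.faceCenter F)
    (hP.sum_smul_faceCenter_mem (fun F => mul_nonneg (by positivity) (hw F))
      (fun F h0 => hG F (right_ne_zero_of_mul h0)) ?_) ?_ hF
  · rw [← Finset.mul_sum, h1, inv_mul_cancel₀ hpos.ne']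
  · simp only [mul_smul, ← Finset.smul_sum]
    rw [smul_smul, mul_inv_cancel₀ hpos.ne', one_smul, h]

/-- Induction on an upper bound G of the support. Removing from both weights the smaller of the two
values at G leaves one with support strictly below G. Total weights are not normalized, so that the
remainders stay within the induction. -/
lemma IsPolytope.chainWeight_ext (hP : IsPolytope P) {w w' : FacePoset P → ℝ}
    (hw : IsChainWeight w) (hw' : IsChainWeight w') (h1 : ∑ F, w F = ∑ F, w' F)
    (h : ∑ F, w F • hP.faceCenter F = ∑ F, w' F • hP.faceCenter F) : w = w' := by
  classical
  suffices H : ∀ (G : FacePoset P) (w w' : FacePoset P → ℝ), IsChainWeight w → IsChainWeight w' →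
      ∑ F, w F = ∑ F, w' F →
      ∑ F, w F • hP.faceCenter F = ∑ F, w' F • hP.faceCenter F →
      (∀ F, w F ≠ 0 → F ≤ G) → w = w' from
    H ⟨P, IsFace.refl hP.nonempty⟩ w w' hw hw' h1 h fun F _ => F.2.subset
  intro G
  induction G using WellFoundedLT.induction with
  | ind G ih =>
    intro w w' hw hw' h1 h hG
    have hG' := hP.chainWeight_support_le hw.nonneg hw'.nonneg hG h1 h
    wlog hle : w G ≤ w' G generalizing w w'
    · exact (this w' w hw' hw h1.symm h.symm hG' hG (le_of_not_ge hle)).symm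
    have hsub : ∀ u : FacePoset P → ℝ, IsChainWeight u → w G ≤ u G →
        IsChainWeight (u - Pi.single G (w G) : FacePoset P → ℝ) := by
      intro u hu hGu
      have hne : ∀ F, (u - Pi.single G (w G) : FacePoset P → ℝ) F ≠ 0 → u F ≠ 0 := by
        intro F hF
        by_cases e : F = G
        · subst e
          intro h0
          have h2 := hw.nonneg F
          rw [Pi.sub_apply, Pi.single_eq_same] at hF
          exact hF (by linarith)
        · simpa [Pi.single_eq_of_ne e] using hF
      refine ⟨fun F => ?_, fun a b ha hb => hu.total a b (hne a ha) (hne b hb)⟩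
      by_cases e : F = G
      · subst e; simpa using hGu
      · simpa [Pi.single_eq_of_ne e] using hu.nonneg F
    have hv := hsub w hw le_rfl
    have hv' := hsub w' hw' hle
    have hv1 : ∑ F, (w - Pi.single G (w G) : FacePoset P → ℝ) F =
        ∑ F, (w' - Pi.single G (w G) : FacePoset P → ℝ) F := by
      simp only [Pi.sub_apply, Finset.sum_sub_distrib, h1]
    have hv2 : ∑ F, (w - Pi.single G (w G) : FacePoset P → ℝ) F • hP.faceCenter F =
        ∑ F, (w' - Pi.single G (w G) : FacePoset P → ℝ) F • hP.faceCenter F := by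
      simp only [Pi.sub_apply, sub_smul, Finset.sum_sub_distrib, h]
    have hvG : (w - Pi.single G (w G) : FacePoset P → ℝ) G = 0 := by simp
    have key : w - Pi.single G (w G) = w' - Pi.single G (w G) := by
      by_cases h0 : w - Pi.single G (w G) = 0
      · rw [h0] at hv1 ⊢
        simp only [Pi.zero_apply, Finset.sum_const_zero] at hv1
        funext F
        exact ((Finset.sum_eq_zero_iff_of_nonneg fun F _ => hv'.nonneg F).1 hv1.symm F
          (Finset.mem_univ F)).symm
      -- The support of the remainder is a chain avoiding G, so its top is a smaller bound.
      · obtain ⟨G₁, hG₁, htop⟩ := hv.exists_top h0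
        have hne : G₁ ≠ G := fun e => hG₁ (e ▸ hvG)
        have hwG₁ : w G₁ ≠ 0 := by simpa [Pi.single_eq_of_ne hne] using hG₁
        exact ih G₁ (lt_of_le_of_ne (hG _ hwG₁) hne) _ _ hv hv' hv1 hv2 htop
    exact sub_left_injective key

variable [FiniteDimensional ℝ E]

/-- Induction on G: project p from the center of G to a boundary point q, which lies in a smaller
face. Scale the weights of q by t and give G the remaining 1 - t. -/
lemma IsPolytope.exists_chainWeight (hP : IsPolytope P) (G : FacePoset P) {p : E} (hp : p ∈ G.1) :
    ∃ w : FacePoset P → ℝ, IsChainWeight w ∧ ∑ F, w F = 1 ∧ (∀ F, w F ≠ 0 → F ≤ G) ∧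
      ∑ F, w F • hP.faceCenter F = p := by
  classical
  induction G using WellFoundedLT.induction generalizing p with
  | ind G ih =>
    have hlt : ∀ q ∈ G.1, q ∉ polytopeCore G.1 → ∃ F < G, q ∈ F.1 := by
      intro q hq hqc
      simp only [polytopeCore, Set.mem_ofPred_eq, not_and, not_forall] at hqc
      obtain ⟨F, hF, hqF, hne⟩ := hqc hq
      exact ⟨⟨F, G.2.trans hP hF⟩,
        lt_of_le_of_ne hF.subset fun e => hne (congrArg Subtype.val e), hqF⟩
    by_cases hpb : p = hP.faceCenter G
    · refine ⟨Pi.single G 1, ⟨fun F => ?_, fun F F' hF hF' => ?_⟩, ?_, fun F hF => ?_, ?_⟩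
      · by_cases e : F = G
        · subst e; simp
        · simp [Pi.single_eq_of_ne e]
      · have e : F = G := by by_contra e; exact hF (Pi.single_eq_of_ne e _)
        have e' : F' = G := by by_contra e; exact hF' (Pi.single_eq_of_ne e _)
        exact Or.inl (e.trans e'.symm).le
      · simp
      · by_contra e
        exact hF (Pi.single_eq_of_ne (fun h => e h.le) _)
      · simp [Pi.single_apply, ite_smul, hpb]
    obtain ⟨q, hq, hqc, t, ⟨ht0, ht1⟩, hpt⟩ :=
      (G.2.isPolytope hP).exists_mem_segment_notMem_polytopeCore (hP.faceCenter_mem G) hp hpb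
    obtain ⟨F, hFG, hqF⟩ := hlt q hq hqc
    obtain ⟨w, hw, hw1, hwF, hwq⟩ := ih F hFG hqF
    have hval : ∀ H, H ≠ G → (Pi.single G (1 - t) + t • w : FacePoset P → ℝ) H = t * w H :=
        fun H hH => by
      simp [Pi.single_eq_of_ne hH]
    have hle : ∀ H, (Pi.single G (1 - t) + t • w : FacePoset P → ℝ) H ≠ 0 →
        H = G ∨ H ≠ G ∧ w H ≠ 0 := by
      intro H hH
      by_cases e : H = G
      · exact Or.inl e
      · rw [hval H e] at hH
        exact Or.inr ⟨e, right_ne_zero_of_mul hH⟩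
    have hle' : ∀ H, (Pi.single G (1 - t) + t • w : FacePoset P → ℝ) H ≠ 0 → H ≤ G := fun H hH =>
      (hle H hH).elim (fun e => e.le) fun h => (hwF H h.2).trans hFG.le
    refine ⟨Pi.single G (1 - t) + t • w, ⟨fun H => ?_, fun a b ha hb => ?_⟩, ?_, hle', ?_⟩
    · refine add_nonneg ?_ (mul_nonneg ht0 (hw.nonneg H))
      by_cases e : H = G
      · subst e; simpa using ht1
      · simp [Pi.single_eq_of_ne e]
    · rcases hle a ha with rfl | ha'
      · exact Or.inr (hle' b hb)
      rcases hle b hb with rfl | hb'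
      · exact Or.inl (hle' a ha)
      exact hw.total a b ha'.2 hb'.2
    · simp [Finset.sum_add_distrib, ← Finset.mul_sum, hw1]
    · simp only [Pi.add_apply, Pi.smul_apply, smul_eq_mul, add_smul, Finset.sum_add_distrib,
        mul_smul, ← Finset.smul_sum, hwq]
      rw [hpt]
      simp [Pi.single_apply, ite_smul]

/-- Barycentric coordinates of a polytope: its points are, uniquely and continuously, the convex
combinations of the centers of the faces in a chain of faces. -/
theorem IsPolytope.exists_coordinates (hP : IsPolytope P) :
    ∃ c : P → FacePoset P → ℝ, Continuous c ∧ (∀ p, IsChainWeight (c p)) ∧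
      (∀ p, ∑ F, c p F = 1) ∧ (∀ p, ∑ F, c p F • hP.faceCenter F = p) ∧
      ∀ (w : FacePoset P → ℝ), IsChainWeight w → ∑ F, w F = 1 →
        ∃ p : P, ∑ F, w F • hP.faceCenter F = p ∧ c p = w := by
  let W : Set (FacePoset P → ℝ) := {w | IsChainWeight w ∧ ∑ F, w F = 1}
  have hWle : ∀ w ∈ W, ∀ F, w F ≤ 1 := fun w hw F =>
    hw.2 ▸ Finset.single_le_sum (fun F _ => hw.1.nonneg F) (Finset.mem_univ F)
  -- Being supported on a chain is a closed condition: the product of the weights of two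
  -- incomparable faces vanishes.
  have hWeq : W = {w | (∀ F, 0 ≤ w F)} ∩ {w | ∀ a b, a ≤ b ∨ b ≤ a ∨ w a * w b = 0} ∩
      {w | ∑ F, w F = 1} := by
    ext w
    constructor
    · intro h
      refine ⟨⟨h.1.nonneg, fun a b => ?_⟩, h.2⟩
      by_cases h0 : w a * w b = 0
      · exact Or.inr (Or.inr h0)
      · have := h.1.total a b (left_ne_zero_of_mul h0) (right_ne_zero_of_mul h0)
        tauto
    · intro h
      refine ⟨⟨h.1.1, fun a b ha hb => ?_⟩, h.2⟩
      have := h.1.2 a b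
      have h0 : w a * w b ≠ 0 := mul_ne_zero ha hb
      tauto
  have hWc : IsClosed W := by
    rw [hWeq]
    refine (IsClosed.inter ?_ ?_).inter (isClosed_eq (by fun_prop) continuous_const)
    · simp only [Set.ofPred_forall]
      exact isClosed_iInter fun F => isClosed_le continuous_const (continuous_apply F)
    · simp only [Set.ofPred_forall]
      refine isClosed_iInter fun a => isClosed_iInter fun b => ?_
      by_cases h : a ≤ b
      · simp [h]
      by_cases h' : b ≤ a
      · simp [h']
      simp only [h, h', false_or]
      exact isClosed_eq (by fun_prop) continuous_const
  have hWk : CompactSpace W := isCompact_iff_compactSpace.1 <|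
    (isCompact_univ_pi fun _ => isCompact_Icc (a := (0 : ℝ)) (b := 1)).of_isClosed_subset hWc
      fun w hw F _ => ⟨hw.1.nonneg F, hWle w hw F⟩
  let Φ : W → P := fun w => ⟨∑ F, w.1 F • hP.faceCenter F,
    hP.sum_smul_faceCenter_mem (G := ⟨P, IsFace.refl hP.nonempty⟩) w.2.1.nonneg
      (fun F _ => F.2.subset) w.2.2⟩
  have hΦ : Continuous Φ := Continuous.subtype_mk (continuous_finsetSum _ fun F _ =>
    ((continuous_apply F).comp continuous_subtype_val).smul continuous_const) _
  have hΦb : Function.Bijective Φ := by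
    constructor
    · intro w w' h
      exact Subtype.ext (hP.chainWeight_ext w.2.1 w'.2.1 (w.2.2.trans w'.2.2.symm)
        (congrArg Subtype.val h))
    · intro p
      obtain ⟨w, hw, h1, -, h⟩ :=
        hP.exists_chainWeight ⟨P, IsFace.refl hP.nonempty⟩ p.2
      exact ⟨⟨w, hw, h1⟩, Subtype.ext h⟩
  -- The coordinates are the inverse of a continuous bijection from a compact space to a Hausdorff
  -- one, hence continuous.
  let e : W ≃ₜ P := hΦ.homeoOfEquivCompactToT2 (f := Equiv.ofBijective Φ hΦb)
  have he : ∀ p, Φ (e.symm p) = p := e.apply_symm_apply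
  refine ⟨fun p => (e.symm p).1, by fun_prop, fun p => (e.symm p).2.1, fun p => (e.symm p).2.2,
    fun p => congrArg Subtype.val (he p), fun w hw h1 => ⟨Φ ⟨w, hw, h1⟩, rfl, ?_⟩⟩
  exact congrArg Subtype.val (e.symm_apply_apply ⟨w, hw, h1⟩)

end BarycentricCoordinates

/-! ### Slices and composition. -/

namespace CategoryTheory.Over

variable {C : Type u} [Category.{v} C]

lemma exists_eq_mk {x : C} (g : Over x) : ∃ (y : C) (f : y ⟶ x), g = Over.mk f :=
  ⟨g.left, g.hom, rfl⟩

lemma mk_injective {x y : C} : Function.Injective (fun f : y ⟶ x => Over.mk f) := by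
  intro f f' h
  injection h

/-- Composition with `f`, from the slice over the source to the slice over the target. -/
def postcomp {x y : C} (f : y ⟶ x) (g : Over y) : Over x := Over.mk (g.hom ≫ f)

lemma postcomp_mk {x y z : C} (f : y ⟶ x) (g : z ⟶ y) :
    postcomp f (Over.mk g) = Over.mk (g ≫ f) := rfl

lemma postcomp_mk_id {x y : C} (f : y ⟶ x) : postcomp f (Over.mk (𝟙 y)) = Over.mk f := by
  rw [postcomp_mk, Category.id_comp]

lemma postcomp_id {x : C} (g : Over x) : postcomp (𝟙 x) g = g := by
  rw [postcomp, Category.comp_id]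
  rfl

lemma postcomp_comp {x y z : C} (g : z ⟶ y) (f : y ⟶ x) (h : Over z) :
    postcomp (g ≫ f) h = postcomp f (postcomp g h) := by
  simp [postcomp]

lemma mem_range_postcomp_iff {x y : C} (f : y ⟶ x) (h : Over x) :
    h ∈ Set.range (postcomp f) ↔ Nonempty (h ⟶ Over.mk f) := by
  constructor
  · rintro ⟨g, rfl⟩
    exact ⟨Over.homMk g.hom⟩
  · rintro ⟨k⟩
    refine ⟨Over.mk k.left, ?_⟩
    have := Over.w k
    simp only [mk_hom] at this
    rw [postcomp_mk, this]
    rfl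

end CategoryTheory.Over

/-! ### Polytopes indexed by a category, and their face maps. -/

/-- Polytopes whose face posets are the slices of a category. -/
structure CellSystem (C : Type u) [Category.{v} C] where
  /-- The dimension of the space containing the polytope. -/
  dim : C → ℕ
  /-- The polytope. -/
  cell : (x : C) → Set (EuclideanSpace ℝ (Fin (dim x)))
  isPolytope : ∀ x, IsPolytope (cell x)
  /-- The slice is the face poset. -/
  iso : ∀ x, IsoCat (Over x) (FacePoset (cell x))

namespace CellSystem

open Over

variable {C : Type u} [Category.{v} C] (S : CellSystem C)

/-- The face corresponding to an object of the slice. -/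
noncomputable def face (x : C) : Over x ≃ FacePoset (S.cell x) := (S.iso x).functor.objEquiv

variable {S}

lemma face_le_iff {x : C} {g h : Over x} : S.face x g ≤ S.face x h ↔ Nonempty (g ⟶ h) :=
  ⟨fun k => ⟨(S.iso x).functor.preimage (homOfLE k)⟩,
    fun ⟨k⟩ => leOfHom ((S.iso x).functor.map k)⟩

include S in
lemma over_hom_ext {x : C} {g h : Over x} (a b : g ⟶ h) : a = b :=
  (S.iso x).functor.map_injective (Subsingleton.elim _ _)

include S in
-- Two morphisms with equal composites with f are parallel in the slice over x, a poset. Hence every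
-- morphism is mono.
lemma comp_right_injective {x y z : C} (f : y ⟶ x) :
    Function.Injective (fun g : z ⟶ y => g ≫ f) := by
  intro g g' h
  have h' : g ≫ f = g' ≫ f := h
  have : (Over.homMk g : Over.mk (g ≫ f) ⟶ Over.mk f) = Over.homMk g' h'.symm :=
    S.over_hom_ext _ _
  exact congrArg CommaMorphism.left this

include S in
lemma over_antisymm {x : C} {g h : Over x} (a : Nonempty (g ⟶ h)) (b : Nonempty (h ⟶ g)) :
    g = h :=
  (S.face x).injective (le_antisymm (face_le_iff.2 a) (face_le_iff.2 b))

include S in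
lemma nonempty_postcomp_hom_iff {x y : C} (f : y ⟶ x) {g h : Over y} :
    Nonempty (postcomp f g ⟶ postcomp f h) ↔ Nonempty (g ⟶ h) := by
  constructor
  · rintro ⟨k⟩
    refine ⟨Over.homMk k.left (S.comp_right_injective f ?_)⟩
    have := Over.w k
    simp only [postcomp, mk_hom] at this
    exact (Category.assoc _ _ _).trans this
  · rintro ⟨k⟩
    exact ⟨Over.homMk k.left (by simp [postcomp])⟩

include S in
lemma postcomp_injective {x y : C} (f : y ⟶ x) : Function.Injective (postcomp f) := fun _ _ e =>
  S.over_antisymm ((S.nonempty_postcomp_hom_iff f).1 ⟨eqToHom e⟩)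
    ((S.nonempty_postcomp_hom_iff f).1 ⟨eqToHom e.symm⟩)

lemma finite_over (S : CellSystem C) (x : C) : Finite (Over x) :=
  have := (S.isPolytope x).finite_facePoset
  Finite.of_equiv _ (S.face x).symm

lemma finite_hom (S : CellSystem C) (x y : C) : Finite (y ⟶ x) :=
  have := S.finite_over x
  Finite.of_injective _ mk_injective

lemma face_mk_id (S : CellSystem C) (x : C) : (S.face x (Over.mk (𝟙 x))).1 = S.cell x := by
  refine Set.Subset.antisymm (IsFace.subset (S.face x _).2) ?_
  have h : (⟨S.cell x, IsFace.refl (S.isPolytope x).nonempty⟩ : FacePoset (S.cell x)) ≤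
      S.face x (Over.mk (𝟙 x)) := by
    obtain ⟨g, hg⟩ := (S.face x).surjective ⟨S.cell x, IsFace.refl (S.isPolytope x).nonempty⟩
    rw [← hg, face_le_iff]
    exact ⟨Over.homMk g.hom⟩
  exact h

lemma dense_interior (S : CellSystem C) (x : C) :
    Dense {p : S.cell x | p.1 ∈ intrinsicInterior ℝ (S.cell x)} := by
  have hP := S.isPolytope x
  rw [Subtype.dense_iff]
  refine hP.subset_closure_polytopeCore.trans (closure_mono ?_)
  rw [← intrinsicInterior_eq_polytopeCore hP.convex]
  exact fun p hp => ⟨⟨p, intrinsicInterior_subset hp⟩, hp, rfl⟩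

/-- Convex weights on a slice, supported on a chain. -/
structure IsWeight {x : C} [Fintype (Over x)] (w : Over x → ℝ) : Prop where
  nonneg : ∀ g, 0 ≤ w g
  total : ∀ g h, w g ≠ 0 → w h ≠ 0 → Nonempty (g ⟶ h) ∨ Nonempty (h ⟶ g)
  sum_eq_one : ∑ g, w g = 1

variable [∀ x : C, Fintype (Over x)]

/-- Barycentric coordinates carried over to the slice by `face`. The last clause reads membership in
a face off the support alone. -/
lemma exists_coord (S : CellSystem C) (x : C) :
    ∃ c : S.cell x → Over x → ℝ, Continuous c ∧ Function.Injective c ∧ (∀ p, IsWeight (c p)) ∧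
      (∀ w : Over x → ℝ, IsWeight w → ∃ p, c p = w) ∧
      ∀ p g, p.1 ∈ (S.face x g).1 ↔ ∀ h, c p h ≠ 0 → Nonempty (h ⟶ g) := by
  let _ : Fintype (FacePoset (S.cell x)) := Fintype.ofEquiv _ (S.face x)
  have hP := S.isPolytope x
  obtain ⟨c, hc, hw, h1, hs, hex⟩ := hP.exists_coordinates
  have hinj : Function.Injective c := fun p q h => Subtype.ext (by rw [← hs p, h, hs q])
  refine ⟨fun p g => c p (S.face x g), ?_, ?_, fun p => ⟨fun g => (hw p).nonneg _, ?_, ?_⟩, ?_, ?_⟩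
  · exact continuous_pi fun g => (continuous_apply _).comp hc
  · intro p q h
    refine hinj (funext fun F => ?_)
    obtain ⟨g, rfl⟩ := (S.face x).surjective F
    exact congrFun h g
  · intro g h hg hh
    simpa only [face_le_iff] using (hw p).total _ _ hg hh
  · rw [← h1 p]
    exact (S.face x).sum_comp (c p)
  · intro w hw
    obtain ⟨p, -, hp⟩ := hex (fun F => w ((S.face x).symm F))
      ⟨fun F => hw.nonneg _, fun F G hF hG => by
        simpa only [← face_le_iff (S := S), Equiv.apply_symm_apply] using hw.total _ _ hF hG⟩
      ((S.face x).symm.sum_comp w ▸ hw.sum_eq_one)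
    exact ⟨p, funext fun g => by simp [hp]⟩
  · intro p g
    constructor
    · intro hp h hh
      rw [← face_le_iff (S := S)]
      exact hP.le_of_sum_smul_faceCenter_mem (w := c p) (hw p).nonneg hp
        (by rw [h1, one_smul, hs]) hh
    · intro h
      rw [← hs p]
      refine hP.sum_smul_faceCenter_mem (hw p).nonneg (fun F hF => ?_) (h1 p)
      obtain ⟨k, rfl⟩ := (S.face x).surjective F
      exact face_le_iff.2 (h k hF)

/-- Barycentric coordinates, indexed by the slice. -/
noncomputable def coord (S : CellSystem C) {x : C} : S.cell x → Over x → ℝ :=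
  (S.exists_coord x).choose

lemma continuous_coord {x : C} : Continuous (S.coord (x := x)) :=
  (S.exists_coord x).choose_spec.1

lemma coord_injective {x : C} : Function.Injective (S.coord (x := x)) :=
  (S.exists_coord x).choose_spec.2.1

lemma isWeight_coord {x : C} (p : S.cell x) : IsWeight (S.coord p) :=
  (S.exists_coord x).choose_spec.2.2.1 p

lemma exists_coord_eq (S : CellSystem C) {x : C} {w : Over x → ℝ} (hw : IsWeight w) :
    ∃ p : S.cell x, S.coord p = w :=
  (S.exists_coord x).choose_spec.2.2.2.1 w hw

lemma mem_face_iff {x : C} {p : S.cell x} {g : Over x} :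
    p.1 ∈ (S.face x g).1 ↔ ∀ h, S.coord p h ≠ 0 → Nonempty (h ⟶ g) :=
  (S.exists_coord x).choose_spec.2.2.2.2 p g

instance (x : C) : CompactSpace (S.cell x) :=
  isCompact_iff_compactSpace.1 (S.isPolytope x).isCompact

lemma isClosedEmbedding_coord {x : C} : Topology.IsClosedEmbedding (S.coord (x := x)) :=
  continuous_coord.isClosedEmbedding coord_injective

/-- The support is a nonempty finite chain; its top is the smallest face containing p. -/
lemma exists_top_coord {x : C} (p : S.cell x) :
    ∃ g, S.coord p g ≠ 0 ∧ p.1 ∈ (S.face x g).1 := by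
  have hne : ∃ g, S.coord p g ≠ 0 := by
    by_contra! h
    have := (isWeight_coord p).sum_eq_one
    simp [h] at this
  obtain ⟨g, hg, hmax⟩ := (Set.toFinite {g | S.coord p g ≠ 0}).exists_maximalFor (S.face x) _ hne
  refine ⟨g, hg, mem_face_iff.2 fun h hh => ?_⟩
  rcases (isWeight_coord p).total g h hg hh with k | k
  · exact face_le_iff.1 (hmax hh (face_le_iff.2 k))
  · exact k

lemma mem_intrinsicInterior_iff {x : C} {p : S.cell x} :
    p.1 ∈ intrinsicInterior ℝ (S.cell x) ↔ S.coord p (Over.mk (𝟙 x)) ≠ 0 := by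
  rw [intrinsicInterior_eq_polytopeCore (S.isPolytope x).convex]
  constructor
  · intro hp
    obtain ⟨g, hg, hpg⟩ := exists_top_coord p
    have h1 := hp.2 _ (S.face x g).2 hpg
    have h2 : g = Over.mk (𝟙 x) :=
      (S.face x).injective (Subtype.ext (h1.trans (S.face_mk_id x).symm))
    exact h2 ▸ hg
  · intro hp
    refine ⟨p.2, fun F hF hpF => Set.Subset.antisymm hF.subset ?_⟩
    obtain ⟨g, hg⟩ := (S.face x).surjective ⟨F, hF⟩
    have hgF : (S.face x g).1 = F := congrArg Subtype.val hg
    rw [← hgF] at hpF ⊢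
    have h1 := mem_face_iff.1 hpF _ hp
    have h2 : S.face x (Over.mk (𝟙 x)) ≤ S.face x g := face_le_iff.2 h1
    exact (S.face_mk_id x).symm.subset.trans h2

include S in
lemma IsWeight.extend {x y : C} (f : y ⟶ x) {w : Over y → ℝ} (hw : IsWeight w) :
    IsWeight (Function.extend (postcomp f) w 0) := by
  have hinj := S.postcomp_injective f
  have hne : ∀ g, Function.extend (postcomp f) w 0 g ≠ 0 → ∃ k, postcomp f k = g ∧ w k ≠ 0 := by
    intro g hg
    by_cases h : ∃ k, postcomp f k = g
    · obtain ⟨k, rfl⟩ := h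
      exact ⟨k, rfl, by rwa [hinj.extend_apply] at hg⟩
    · exact absurd (Function.extend_apply' _ _ _ h) hg
  refine ⟨fun g => ?_, fun g h hg hh => ?_, ?_⟩
  · by_cases h : Function.extend (postcomp f) w 0 g = 0
    · exact h.ge
    · obtain ⟨k, rfl, -⟩ := hne g h
      rw [hinj.extend_apply]
      exact hw.nonneg k
  · obtain ⟨k, rfl, hk⟩ := hne g hg
    obtain ⟨l, rfl, hl⟩ := hne h hh
    rw [S.nonempty_postcomp_hom_iff, S.nonempty_postcomp_hom_iff]
    exact hw.total k l hk hl
  · rw [← hw.sum_eq_one]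
    refine (Fintype.sum_of_injective _ hinj _ _ (fun g hg => ?_) fun g => ?_).symm
    · exact Function.extend_apply' _ _ _ hg
    · exact (hinj.extend_apply _ _ g).symm

/-- The map of polytopes given by a morphism, linear on the barycentric subdivision. -/
noncomputable def faceMap (S : CellSystem C) {x y : C} (f : y ⟶ x) (p : S.cell y) : S.cell x :=
  (S.exists_coord_eq (IsWeight.extend (S := S) f (isWeight_coord p))).choose

lemma coord_faceMap {x y : C} (f : y ⟶ x) (p : S.cell y) :
    S.coord (S.faceMap f p) = Function.extend (postcomp f) (S.coord p) 0 :=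
  (S.exists_coord_eq (IsWeight.extend (S := S) f (isWeight_coord p))).choose_spec

lemma coord_faceMap_postcomp {x y : C} (f : y ⟶ x) (p : S.cell y) (g : Over y) :
    S.coord (S.faceMap f p) (postcomp f g) = S.coord p g := by
  rw [coord_faceMap, (S.postcomp_injective f).extend_apply]

lemma coord_faceMap_mk {x y : C} (f : y ⟶ x) (p : S.cell y) :
    S.coord (S.faceMap f p) (Over.mk f) = S.coord p (Over.mk (𝟙 y)) := by
  rw [← coord_faceMap_postcomp f, postcomp_mk_id]

lemma coord_faceMap_of_notMem {x y : C} (f : y ⟶ x) (p : S.cell y) {h : Over x}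
    (hh : h ∉ Set.range (postcomp f)) : S.coord (S.faceMap f p) h = 0 := by
  rw [coord_faceMap]
  exact Function.extend_apply' _ _ _ hh

lemma faceMap_injective {x y : C} (f : y ⟶ x) : Function.Injective (S.faceMap f) := by
  intro p q h
  refine coord_injective (funext fun g => ?_)
  rw [← coord_faceMap_postcomp f, h, coord_faceMap_postcomp]

lemma continuous_faceMap {x y : C} (f : y ⟶ x) : Continuous (S.faceMap f) := by
  refine isClosedEmbedding_coord.isEmbedding.continuous_iff.2 (continuous_pi fun h => ?_)
  by_cases hh : h ∈ Set.range (postcomp f)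
  · obtain ⟨g, rfl⟩ := hh
    simp only [Function.comp_apply, coord_faceMap_postcomp]
    exact (continuous_apply g).comp continuous_coord
  · simp only [Function.comp_apply, coord_faceMap_of_notMem f _ hh]
    exact continuous_const

lemma faceMap_id {x : C} (p : S.cell x) : S.faceMap (𝟙 x) p = p := by
  refine coord_injective (funext fun g => ?_)
  rw [← coord_faceMap_postcomp (𝟙 x) p, postcomp_id]

/-- Extensions by zero along injections compose, so functoriality holds on the nose. -/
lemma faceMap_comp {x y z : C} (g : z ⟶ y) (f : y ⟶ x) (p : S.cell z) :
    S.faceMap (g ≫ f) p = S.faceMap f (S.faceMap g p) := by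
  refine coord_injective (funext fun h => ?_)
  by_cases hh : h ∈ Set.range (postcomp f)
  · obtain ⟨k, rfl⟩ := hh
    rw [coord_faceMap_postcomp]
    by_cases hk : k ∈ Set.range (postcomp g)
    · obtain ⟨l, rfl⟩ := hk
      rw [← postcomp_comp, coord_faceMap_postcomp, coord_faceMap_postcomp]
    · rw [coord_faceMap_of_notMem g _ hk, coord_faceMap_of_notMem]
      rintro ⟨l, hl⟩
      rw [postcomp_comp] at hl
      exact hk ⟨l, S.postcomp_injective f hl⟩
  · rw [coord_faceMap_of_notMem f _ hh, coord_faceMap_of_notMem]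
    rintro ⟨l, rfl⟩
    exact hh ⟨_, (postcomp_comp g f l).symm⟩

lemma faceMap_mem_face_iff {x y : C} (f : y ⟶ x) (p : S.cell y) (g : Over y) :
    (S.faceMap f p).1 ∈ (S.face x (postcomp f g)).1 ↔ p.1 ∈ (S.face y g).1 := by
  rw [mem_face_iff, mem_face_iff]
  constructor
  · intro h k hk
    rw [← S.nonempty_postcomp_hom_iff f]
    exact h _ (by rwa [coord_faceMap_postcomp])
  · intro h k hk
    by_cases hk' : k ∈ Set.range (postcomp f)
    · obtain ⟨l, rfl⟩ := hk'
      rw [S.nonempty_postcomp_hom_iff f]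
      exact h _ (by rwa [coord_faceMap_postcomp] at hk)
    · exact absurd (coord_faceMap_of_notMem f p hk') hk

lemma faceMap_mem_face {x y : C} (f : y ⟶ x) (p : S.cell y) :
    (S.faceMap f p).1 ∈ (S.face x (Over.mk f)).1 := by
  rw [← postcomp_mk_id, faceMap_mem_face_iff, face_mk_id]
  exact p.2

/-- A point of the face has its support below f, that is, in the range of `postcomp f`, so its
coordinates restrict to a weight on the slice over y. -/
lemma exists_faceMap_eq {x y : C} (f : y ⟶ x) {p : S.cell x} (hp : p.1 ∈ (S.face x (Over.mk f)).1) :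
    ∃ q, S.faceMap f q = p := by
  have hinj := S.postcomp_injective f
  have hout : ∀ h, h ∉ Set.range (postcomp f) → S.coord p h = 0 := by
    intro h hh
    by_contra h0
    exact hh ((mem_range_postcomp_iff f h).2 (mem_face_iff.1 hp h h0))
  have hw : IsWeight fun g : Over y => S.coord p (postcomp f g) := by
    refine ⟨fun g => (isWeight_coord p).nonneg _, fun g h hg hh => ?_, ?_⟩
    · simpa only [S.nonempty_postcomp_hom_iff] using (isWeight_coord p).total _ _ hg hh
    · rw [← (isWeight_coord p).sum_eq_one]
      exact Fintype.sum_of_injective _ hinj _ _ hout fun g => rfl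
  obtain ⟨q, hq⟩ := S.exists_coord_eq hw
  refine ⟨q, coord_injective (funext fun h => ?_)⟩
  by_cases hh : h ∈ Set.range (postcomp f)
  · obtain ⟨k, rfl⟩ := hh
    rw [coord_faceMap_postcomp, hq]
  · rw [coord_faceMap_of_notMem f _ hh, hout h hh]

/-- The homeomorphism from a polytope onto a face given by a morphism. -/
noncomputable def faceHomeo (S : CellSystem C) {x y : C} (f : y ⟶ x) :
    S.cell y ≃ₜ (S.face x (Over.mk f)).1 :=
  Continuous.homeoOfEquivCompactToT2
    (f := Equiv.ofBijective (fun p => (⟨(S.faceMap f p).1, faceMap_mem_face f p⟩ :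
        (S.face x (Over.mk f)).1))
      ⟨fun p q h => faceMap_injective f (Subtype.ext (Subtype.ext_iff.1 h :)), fun q => by
        obtain ⟨p, hp⟩ := exists_faceMap_eq (S := S) f
          (p := ⟨q.1, IsFace.subset (S.face x (Over.mk f)).2 q.2⟩) q.2
        exact ⟨p, Subtype.ext (Subtype.ext_iff.1 hp :)⟩⟩)
    ((continuous_subtype_val.comp (continuous_faceMap f)).subtype_mk _)

lemma coe_faceHomeo {x y : C} (f : y ⟶ x) (p : S.cell y) :
    (S.faceHomeo f p : EuclideanSpace ℝ (Fin (S.dim x))) = (S.faceMap f p).1 := rfl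

lemma faceHomeo_image_face {x y : C} (f : y ⟶ x) (g : Over y) {T : Set (S.cell y)}
    (hT : (↑) '' T = (S.face y g).1) :
    (↑) '' (S.faceHomeo f '' T) = (S.face x (postcomp f g)).1 := by
  have hT' : ∀ p : S.cell y, p ∈ T ↔ p.1 ∈ (S.face y g).1 := fun p => by
    rw [← hT, Subtype.val_injective.mem_set_image]
  ext z
  constructor
  · rintro ⟨-, ⟨p, hp, rfl⟩, rfl⟩
    exact (faceMap_mem_face_iff f p g).2 ((hT' p).1 hp)
  · intro hz
    have hzf : z ∈ (S.face x (Over.mk f)).1 :=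
      (show S.face x (postcomp f g) ≤ S.face x (Over.mk f) from
        face_le_iff.2 ((mem_range_postcomp_iff f _).1 ⟨g, rfl⟩)) hz
    obtain ⟨p, hp⟩ := (S.faceHomeo f).surjective ⟨z, hzf⟩
    have hpz : (S.faceMap f p).1 = z := congrArg Subtype.val hp
    exact ⟨_, ⟨p, (hT' p).2 ((faceMap_mem_face_iff f p g).1 (hpz ▸ hz)), rfl⟩, hpz⟩

lemma isPolyhedralHomeo_faceHomeo {x y : C} (f : y ⟶ x) :
    IsPolyhedralHomeo (S.faceHomeo f) := by
  intro T
  constructor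
  · intro hT
    obtain ⟨g, hg⟩ := (S.face y).surjective ⟨_, hT⟩
    have hg' := congrArg Subtype.val hg
    rw [faceHomeo_image_face f g hg'.symm]
    exact (S.face x (postcomp f g)).2.mono (IsFace.subset (S.face x (Over.mk f)).2)
      (show S.face x (postcomp f g) ≤ S.face x (Over.mk f) from
        face_le_iff.2 ((mem_range_postcomp_iff f _).1 ⟨g, rfl⟩))
  · intro hT
    obtain ⟨h, hh⟩ := (S.face x).surjective
      ⟨_, (S.face x (Over.mk f)).2.trans (S.isPolytope x) hT⟩
    have hle : S.face x h ≤ S.face x (Over.mk f) := by rw [hh]; exact hT.subset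
    obtain ⟨g, rfl⟩ := (mem_range_postcomp_iff f h).2 (face_le_iff.1 hle)
    have hg : ((↑) '' ((↑) ⁻¹' (S.face y g).1 : Set (S.cell y)) :
        Set (EuclideanSpace ℝ (Fin (S.dim y)))) = (S.face y g).1 := by
      rw [Subtype.image_preimage_coe, Set.inter_eq_right]
      exact IsFace.subset (S.face y g).2
    have e := (faceHomeo_image_face f g hg).trans (congrArg Subtype.val hh)
    have e' := (S.faceHomeo f).injective.image_injective (Subtype.val_injective.image_injective e)
    rw [← e', hg]
    exact (S.face y g).2

lemma isFaceMap_faceMap {x y : C} (f : y ⟶ x) : IsFaceMap (S.faceMap f) :=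
  ⟨_, (S.face x (Over.mk f)).2, S.faceHomeo f, isPolyhedralHomeo_faceHomeo f, fun _ => rfl⟩

end CellSystem

namespace IsAcyclicCategory

variable {C : Type u} [Category.{v} C]

lemma eq_of_hom (hC : IsAcyclicCategory C) {x y : C} (f : x ⟶ y) (g : y ⟶ x) : x = y :=
  hC.eq_of_isIso x y f ⟨g, hC.endo_eq_id _ _, hC.endo_eq_id _ _⟩

end IsAcyclicCategory

/-! ### The glued space and its characteristic maps. -/

namespace CellSystem

open Over

variable {C : Type u} [Category.{v} C] {S : CellSystem C}
  [∀ x : C, Fintype (Over x)]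

variable (S) in
/-- The points of the complex: the disjoint union of the relative interiors of the polytopes. -/
structure Realization : Type u where
  base : C
  point : S.cell base
  mem_interior : point.1 ∈ intrinsicInterior ℝ (S.cell base)

lemma exists_realization {x : C} (p : S.cell x) :
    ∃ (k : S.Realization) (f : k.base ⟶ x), S.faceMap f k.point = p := by
  obtain ⟨g, hg, hpg⟩ := exists_top_coord p
  obtain ⟨y, f, rfl⟩ := g.exists_eq_mk
  obtain ⟨q, rfl⟩ := exists_faceMap_eq f hpg
  exact ⟨⟨y, q, mem_intrinsicInterior_iff.2 (by rwa [coord_faceMap_mk] at hg)⟩, f, rfl⟩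

/-- The characteristic map of a polytope. -/
noncomputable def charMap (S : CellSystem C) (x : C) (p : S.cell x) : S.Realization :=
  (exists_realization p).choose

lemma exists_faceMap_charMap {x : C} (p : S.cell x) :
    ∃ f : (S.charMap x p).base ⟶ x, S.faceMap f (S.charMap x p).point = p :=
  (exists_realization p).choose_spec

/-- The common image has nonzero coordinate at f and is supported below f', so f lies below f'; by
symmetry the two coincide in the slice. -/
lemma realization_eq {x : C} (k k' : S.Realization) (f : k.base ⟶ x) (f' : k'.base ⟶ x)
    (h : S.faceMap f k.point = S.faceMap f' k'.point) : k = k' := by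
  have key : ∀ (k k' : S.Realization) (f : k.base ⟶ x) (f' : k'.base ⟶ x),
      S.faceMap f k.point = S.faceMap f' k'.point → Nonempty (Over.mk f ⟶ Over.mk f') := by
    intro k k' f f' h
    have h0 := mem_intrinsicInterior_iff.1 k.mem_interior
    rw [← coord_faceMap_mk f, h] at h0
    rw [← mem_range_postcomp_iff]
    by_contra hn
    exact h0 (coord_faceMap_of_notMem f' _ hn)
  have e := S.over_antisymm (key k k' f f' h) (key k' k f' f h.symm)
  obtain ⟨y, p, hp⟩ := k
  obtain ⟨y', p', hp'⟩ := k'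
  obtain rfl : y = y' := congrArg Comma.left e
  obtain rfl : f = f' := mk_injective e
  obtain rfl := faceMap_injective f h
  rfl

lemma charMap_eq {x : C} {p : S.cell x} (k : S.Realization) (f : k.base ⟶ x)
    (h : S.faceMap f k.point = p) : S.charMap x p = k := by
  obtain ⟨f', h'⟩ := exists_faceMap_charMap p
  exact realization_eq _ _ f' f (h'.trans h.symm)

lemma charMap_faceMap {x y : C} (f : y ⟶ x) (p : S.cell y) :
    S.charMap x (S.faceMap f p) = S.charMap y p := by
  obtain ⟨g, h⟩ := exists_faceMap_charMap p
  exact charMap_eq _ (g ≫ f) (by rw [faceMap_comp, h])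

lemma charMap_of_mem_interior {x : C} {p : S.cell x}
    (hp : p.1 ∈ intrinsicInterior ℝ (S.cell x)) : S.charMap x p = ⟨x, p, hp⟩ :=
  charMap_eq ⟨x, p, hp⟩ (𝟙 x) (faceMap_id p)

lemma charMap_point (k : S.Realization) : S.charMap k.base k.point = k :=
  charMap_of_mem_interior k.mem_interior

noncomputable instance : TopologicalSpace S.Realization :=
  TopologicalSpace.coinduced (fun p : Σ x, S.cell x => S.charMap p.1 p.2) inferInstance

lemma continuous_charMap (x : C) : Continuous (S.charMap x) :=
  (continuous_coinduced_rng (f := fun p : Σ x, S.cell x => S.charMap p.1 p.2)).comp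
    continuous_sigmaMk

lemma continuous_dom_iff {Z : Type*} [TopologicalSpace Z] {F : S.Realization → Z} :
    Continuous F ↔ ∀ x, Continuous fun p => F (S.charMap x p) := by
  rw [continuous_coinduced_dom, continuous_sigma_iff]
  rfl

lemma isClosed_realization_iff {A : Set S.Realization} :
    IsClosed A ↔ ∀ x, IsClosed (S.charMap x ⁻¹' A) := by
  rw [isClosed_coinduced, isClosed_sigma_iff]
  rfl

/-! ### Separation of points by continuous functions. -/

section Hausdorff

variable [∀ x y : C, Fintype (x ⟶ y)]

/-- A continuous function on a polytope, given by a morphism. -/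
noncomputable def edgeFun (S : CellSystem C) {a b : C} (m : a ⟶ b) {x : C} (p : S.cell x) : ℝ :=
  ∑ g : b ⟶ x, S.coord p (Over.mk (m ≫ g)) * S.coord p (Over.mk g)

lemma continuous_edgeFun {a b : C} (m : a ⟶ b) {x : C} :
    Continuous (S.edgeFun m (x := x)) :=
  continuous_finsetSum _ fun _ _ => ((continuous_apply _).comp continuous_coord).mul
    ((continuous_apply _).comp continuous_coord)

/-- Terms whose g does not factor through f vanish, and the others keep their coordinates. So
`edgeFun` descends to the glued space. -/
lemma edgeFun_faceMap {a b : C} (m : a ⟶ b) {x y : C} (f : y ⟶ x) (p : S.cell y) :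
    S.edgeFun m (S.faceMap f p) = S.edgeFun m p := by
  refine (Fintype.sum_of_injective _ (S.comp_right_injective f) _ _ (fun g hg => ?_)
    fun g => ?_).symm
  · rw [coord_faceMap_of_notMem f p (h := Over.mk g), mul_zero]
    rintro ⟨k, hk⟩
    obtain ⟨z, k, rfl⟩ := k.exists_eq_mk
    obtain rfl : z = b := congrArg Comma.left hk
    exact hg ⟨k, mk_injective hk⟩
  · have h1 := coord_faceMap_postcomp f p (Over.mk (m ≫ g))
    have h2 := coord_faceMap_postcomp f p (Over.mk g)
    rw [postcomp_mk] at h1 h2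
    rw [← h1, ← h2, Category.assoc]

lemma edgeFun_charMap {a b : C} (m : a ⟶ b) {x : C} (p : S.cell x) :
    S.edgeFun m (S.charMap x p).point = S.edgeFun m p := by
  obtain ⟨f, h⟩ := exists_faceMap_charMap p
  conv_rhs => rw [← h, edgeFun_faceMap]

lemma edgeFun_over (hC : IsAcyclicCategory C) {x y : C} (f : y ⟶ x) (p : S.cell x) :
    S.edgeFun f p = S.coord p (Over.mk f) * S.coord p (Over.mk (𝟙 x)) := by
  have : Subsingleton (x ⟶ x) :=
    ⟨fun a b => (hC.endo_eq_id x a).trans (hC.endo_eq_id x b).symm⟩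
  rw [edgeFun, Fintype.sum_subsingleton _ (𝟙 x), Category.comp_id]

/-- For an identity m, `edgeFun` is a sum of squares, positive at an interior point of that cell;
this yields morphisms both ways between the bases, which therefore agree. On a common cell x, a
morphism into x gives its coordinate times the nonzero top coordinate. -/
lemma realization_ext (hC : IsAcyclicCategory C) {k k' : S.Realization}
    (h : ∀ (a b : C) (m : a ⟶ b), S.edgeFun m k.point = S.edgeFun m k'.point) : k = k' := by
  have key : ∀ k k' : S.Realization,
      (∀ (a b : C) (m : a ⟶ b), S.edgeFun m k.point = S.edgeFun m k'.point) →
      Nonempty (k.base ⟶ k'.base) := by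
    intro k k' h
    by_contra hn
    have := not_nonempty_iff.1 hn
    have h0 := mem_intrinsicInterior_iff.1 k.mem_interior
    have h1 := h _ _ (𝟙 k.base)
    rw [edgeFun_over hC, edgeFun, Fintype.sum_empty] at h1
    exact h0 (mul_self_eq_zero.1 h1)
  obtain ⟨f⟩ := key k k' h
  obtain ⟨f'⟩ := key k' k fun a b m => (h a b m).symm
  obtain ⟨x, p, hp⟩ := k
  obtain ⟨y, q, hq⟩ := k'
  obtain rfl : x = y := hC.eq_of_hom f f'
  have hp0 := mem_intrinsicInterior_iff.1 hp
  have hc : ∀ {y : C} (f : y ⟶ x), S.coord p (Over.mk f) * S.coord p (Over.mk (𝟙 x)) =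
      S.coord q (Over.mk f) * S.coord q (Over.mk (𝟙 x)) := fun f => by
    rw [← edgeFun_over hC, ← edgeFun_over hC]
    exact h _ _ f
  -- The identity gives the square of the top coordinate, which determines it by nonnegativity.
  have h1 : S.coord p (Over.mk (𝟙 x)) = S.coord q (Over.mk (𝟙 x)) :=
    (mul_self_inj ((isWeight_coord p).nonneg _) ((isWeight_coord q).nonneg _)).1 (hc (𝟙 x))
  obtain rfl : p = q := by
    refine coord_injective (funext fun g => ?_)
    obtain ⟨y, g, rfl⟩ := g.exists_eq_mk
    have := hc g
    rw [← h1] at this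
    exact mul_right_cancel₀ hp0 this
  rfl

lemma t2Space_realization (hC : IsAcyclicCategory C) : T2Space S.Realization := by
  let Φ : S.Realization → (Σ (a b : C), (a ⟶ b)) → ℝ := fun k m => S.edgeFun m.2.2 k.point
  refine T2Space.of_injective_continuous (f := Φ)
    (fun k k' h => realization_ext hC fun a b m => congrFun h ⟨a, b, m⟩)
    (continuous_pi fun m => continuous_dom_iff.2 fun x => ?_)
  simp only [Φ, edgeFun_charMap]
  exact continuous_edgeFun _

end Hausdorff

/-! ### The polyhedral CW complex and its face category. -/

lemma base_charMap_iff (hC : IsAcyclicCategory C) {x : C} (p : S.cell x) :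
    (S.charMap x p).base = x ↔ p.1 ∈ intrinsicInterior ℝ (S.cell x) := by
  constructor
  · intro h
    obtain ⟨f, hf⟩ := exists_faceMap_charMap p
    generalize S.charMap x p = k at h f hf
    obtain ⟨y, q, hq⟩ := k
    obtain rfl : y = x := h
    rw [hC.endo_eq_id _ f, faceMap_id] at hf
    exact hf ▸ hq
  · intro h
    rw [charMap_of_mem_interior h]

lemma charMap_injOn {x : C} {p q : S.cell x} (hp : p.1 ∈ intrinsicInterior ℝ (S.cell x))
    (hq : q.1 ∈ intrinsicInterior ℝ (S.cell x)) (h : S.charMap x p = S.charMap x q) : p = q := by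
  rw [charMap_of_mem_interior hp, charMap_of_mem_interior hq] at h
  injection h

/-- The characteristic map is closed, and the relative interior is the full preimage of the points
based at x. The restriction to a full preimage stays closed and is injective here. -/
lemma isEmbedding_charMap (hC : IsAcyclicCategory C) [T2Space S.Realization] (x : C) :
    Topology.IsEmbedding
      (fun p : {p : S.cell x // p.1 ∈ intrinsicInterior ℝ (S.cell x)} => S.charMap x p.1) := by
  let A : Set S.Realization := {k | k.base = x}
  have hcl : IsClosedMap (S.charMap x) := (continuous_charMap x).isClosedMap
  have h1 : Topology.IsClosedEmbedding (A.restrictPreimage (S.charMap x)) :=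
    .of_continuous_injective_isClosedMap (continuous_charMap x).restrictPreimage
      (fun p q h => Subtype.ext (charMap_injOn ((base_charMap_iff hC _).1 p.2)
        ((base_charMap_iff hC _).1 q.2) (congrArg Subtype.val h))) (hcl.restrictPreimage A)
  have hA : {p : S.cell x | p.1 ∈ intrinsicInterior ℝ (S.cell x)} = S.charMap x ⁻¹' A :=
    Set.ext fun p => (base_charMap_iff hC p).symm
  exact (Topology.IsEmbedding.subtypeVal.comp h1.isEmbedding).comp
    (Homeomorph.setCongr hA).isEmbedding

/-- The polyhedral CW complex of a system of polytopes. -/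
noncomputable def complex (S : CellSystem C) (hC : IsAcyclicCategory C) [T2Space S.Realization] :
    PolyhedralCWComplex S.Realization where
  Index := C
  dim := S.dim
  cell := S.cell
  isPolytope := S.isPolytope
  map := S.charMap
  continuous_map := continuous_charMap
  isEmbedding_interior := isEmbedding_charMap hC
  existsUnique_mem k := by
    refine ⟨k.base, ⟨k.point, k.mem_interior, charMap_point k⟩, ?_⟩
    rintro x ⟨p, hp, rfl⟩
    exact ((base_charMap_iff hC p).2 hp).symm
  isClosed_iff A := by
    constructor
    · exact fun h x => h.inter (isCompact_range (continuous_charMap x)).isClosed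
    · refine fun h => isClosed_realization_iff.2 fun x => ?_
      have := (h x).preimage (continuous_charMap x)
      rwa [Set.preimage_inter, Set.preimage_range, Set.inter_univ] at this
  exists_face x F hF := by
    obtain ⟨g, hg⟩ := (S.face x).surjective ⟨F, hF⟩
    obtain ⟨y, f, rfl⟩ := g.exists_eq_mk
    obtain rfl : (S.face x (Over.mk f)).1 = F := congrArg Subtype.val hg
    exact ⟨y, S.faceHomeo f, isPolyhedralHomeo_faceHomeo f, fun p => (charMap_faceMap f p).symm⟩

variable (S) in
/-- The functor to the face category of the complex. -/
noncomputable def toFaceCategory (hC : IsAcyclicCategory C) [T2Space S.Realization] :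
    C ⥤ (S.complex hC).FaceCategory where
  obj x := ⟨x⟩
  map f := ⟨S.faceMap f, isFaceMap_faceMap f, charMap_faceMap f⟩
  map_id _ := Subtype.ext (funext faceMap_id)
  map_comp g f := Subtype.ext (funext (faceMap_comp g f))

/-- A homeomorphism of polytopes compatible with the characteristic maps is the identity. -/
lemma homeo_eq_id (hC : IsAcyclicCategory C) {y z : C} (ψ : S.cell y ≃ₜ S.cell z)
    (h : ∀ p, S.charMap z (ψ p) = S.charMap y p) :
    ∃ e : y = z, ∀ p, ψ p = S.faceMap (eqToHom e) p := by
  have key : ∀ {y z : C} (ψ : S.cell y ≃ₜ S.cell z)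
      (_ : ∀ p, S.charMap z (ψ p) = S.charMap y p), Nonempty (y ⟶ z) := by
    intro y z ψ h
    -- An interior point of P_y has base y in the glued space; seen as the image of ψ p, it comes
    -- with a morphism y ⟶ z.
    obtain ⟨p⟩ := (S.isPolytope y).nonempty.to_subtype
    obtain ⟨p, hp⟩ := (S.dense_interior y).nonempty_iff.2 ⟨p⟩
    obtain ⟨f, -⟩ := exists_faceMap_charMap (ψ p)
    rw [h, charMap_of_mem_interior hp] at f
    exact ⟨f⟩
  obtain ⟨f⟩ := key ψ h
  obtain ⟨f'⟩ := key ψ.symm fun p => by rw [← h, ψ.apply_symm_apply]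
  obtain rfl := hC.eq_of_hom f f'
  refine ⟨rfl, fun p => ?_⟩
  rw [eqToHom_refl, faceMap_id]
  refine congrFun (ψ.continuous.ext_on (S.dense_interior y) continuous_id fun p hp => ?_) p
  have hb := (base_charMap_iff hC (ψ p)).1 (by rw [h, charMap_of_mem_interior hp])
  exact charMap_injOn hb hp (h p)

lemma faceMap_morphism_injective {x y : C} :
    Function.Injective (fun f : y ⟶ x => S.faceMap f) := by
  intro f f' h
  have key : ∀ f f' : y ⟶ x, S.faceMap f = S.faceMap f' →
      S.face x (Over.mk f) ≤ S.face x (Over.mk f') := by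
    intro f f' h p hp
    obtain ⟨q, hq⟩ := exists_faceMap_eq f (p := ⟨p, IsFace.subset (S.face x _).2 hp⟩) hp
    have := faceMap_mem_face f' q
    rwa [← h, hq] at this
  exact mk_injective ((S.face x).injective (le_antisymm (key _ _ h) (key _ _ h.symm)))

/-- The image of φ is the face of some f : z ⟶ x. Comparing φ with `faceMap f` gives a homeomorphism
from P_y to P_z over the glued space, to which `homeo_eq_id` applies. -/
lemma exists_faceMap_eq_of_isFaceMap (hC : IsAcyclicCategory C) {x y : C}
    {φ : S.cell y → S.cell x} (hφ : IsFaceMap φ)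
    (hm : ∀ p, S.charMap x (φ p) = S.charMap y p) : ∃ f : y ⟶ x, S.faceMap f = φ := by
  obtain ⟨F, hF, χ, -, hχ⟩ := hφ
  obtain ⟨g, hg⟩ := (S.face x).surjective ⟨F, hF⟩
  obtain ⟨z, f, rfl⟩ := g.exists_eq_mk
  obtain rfl : (S.face x (Over.mk f)).1 = F := congrArg Subtype.val hg
  have hψ : ∀ p, S.faceMap f ((χ.trans (S.faceHomeo f).symm) p) = φ p := by
    intro p
    refine Subtype.ext ((coe_faceHomeo f _).symm.trans ?_)
    rw [hχ]
    exact congrArg Subtype.val ((S.faceHomeo f).apply_symm_apply (χ p))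
  obtain ⟨e, he⟩ := homeo_eq_id hC (χ.trans (S.faceHomeo f).symm) fun p => by
    rw [← charMap_faceMap f, hψ, hm]
  exact ⟨eqToHom e ≫ f, funext fun p => by rw [faceMap_comp, ← he, hψ]⟩

lemma isIso_toFaceCategory (hC : IsAcyclicCategory C) [T2Space S.Realization] :
    (S.toFaceCategory hC).IsIso where
  faithful := ⟨fun h => faceMap_morphism_injective (congrArg Subtype.val h)⟩
  full := ⟨fun φ =>
    let ⟨f, hf⟩ := exists_faceMap_eq_of_isFaceMap hC φ.2.1 φ.2.2
    ⟨f, Subtype.ext hf⟩⟩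
  bijective_obj := ⟨fun _ _ h => congrArg PolyhedralCWComplex.FaceCategory.index h,
    fun x => ⟨x.index, rfl⟩⟩

end CellSystem

theorem exists_polyhedralCWComplex {C : Type u} [Category.{v} C] (hC : IsAcyclicCategory C)
    (h : ∀ x : C, ∃ (n : ℕ) (P : Set (EuclideanSpace ℝ (Fin n))), IsPolytope P ∧
      Nonempty (IsoCat (Over x) (FacePoset P))) :
    ∃ (K : Type u) (_ : TopologicalSpace K) (_ : T2Space K) (X : PolyhedralCWComplex K),
      Nonempty (IsoCat C X.FaceCategory) := by
  choose n P hP e using h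
  let S : CellSystem C := ⟨n, P, hP, fun x => (e x).some⟩
  have := S.finite_over
  have := fun x y => S.finite_hom y x
  let _ : ∀ x : C, Fintype (Over x) := fun x => Fintype.ofFinite _
  let _ : ∀ x y : C, Fintype (x ⟶ y) := fun x y => Fintype.ofFinite _
  have hT := CellSystem.t2Space_realization (S := S) hC
  have := CellSystem.isIso_toFaceCategory (S := S) hC
  exact ⟨S.Realization, inferInstance, hT, S.complex hC, ⟨(S.toFaceCategory hC).asIsomorphism⟩⟩

/-! ### Conversely, slices of a face category are face posets. -/

lemma image_range_eq_of_homeo {E E' : Type*} [TopologicalSpace E]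
    [TopologicalSpace E'] {P : Set E} {Q F : Set E'} {f : P → Q} (φ : P ≃ₜ F)
    (hφ : ∀ x, (f x : E') = φ x) : (↑) '' Set.range f = F := by
  ext z
  constructor
  · rintro ⟨-, ⟨x, rfl⟩, rfl⟩
    rw [hφ]
    exact (φ x).2
  · intro hz
    exact ⟨f (φ.symm ⟨z, hz⟩), ⟨_, rfl⟩, by rw [hφ, φ.apply_symm_apply]⟩

section FaceMaps

variable {E E' E'' : Type*} [NormedAddCommGroup E] [NormedSpace ℝ E]
  [NormedAddCommGroup E'] [NormedSpace ℝ E'] [NormedAddCommGroup E''] [NormedSpace ℝ E'']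

lemma IsFaceMap.injective {P : Set E} {Q : Set E'} {f : P → Q} (hf : IsFaceMap f) :
    Function.Injective f := by
  obtain ⟨F, hF, φ, -, hφ⟩ := hf
  intro x y h
  exact φ.injective (Subtype.ext (by rw [← hφ, ← hφ, h]))

lemma IsFaceMap.isFace_range {P : Set E} {Q : Set E'} {f : P → Q} (hf : IsFaceMap f) :
    IsFace Q ((↑) '' Set.range f) := by
  obtain ⟨F, hF, φ, -, hφ⟩ := hf
  rwa [image_range_eq_of_homeo φ hφ]

/-- A face map factors through every face map with a larger image. -/
lemma IsFaceMap.exists_factor {P : Set E} {P' : Set E''} {Q : Set E'} (hP' : IsPolytope P')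
    (hQ : IsPolytope Q) {f : P → Q} {g : P' → Q} (hf : IsFaceMap f) (hg : IsFaceMap g)
    (hle : Set.range f ⊆ Set.range g) : ∃ h : P → P', IsFaceMap h ∧ ∀ x, g (h x) = f x := by
  obtain ⟨F, hF, φ, hφ, hfφ⟩ := hf
  obtain ⟨G, hG, ψ, hψ, hgψ⟩ := hg
  have hFG : F ⊆ G := by
    rw [← image_range_eq_of_homeo φ hfφ, ← image_range_eq_of_homeo ψ hgψ]
    exact Set.image_mono hle
  -- The factor is ψ⁻¹ after φ; ι is ψ⁻¹ restricted to the smaller face F.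
  let ι : F → P' := fun y => ψ.symm ⟨y.1, hFG y.2⟩
  have hι : ∀ y, (ψ (ι y) : E') = y := fun y => by simp [ι]
  have himg : ∀ T : Set F, ((↑) '' (ψ '' (ι '' T)) : Set E') = (↑) '' T := by
    intro T
    simp only [Set.image_image, hι]
  set H : Set E'' := (↑) '' Set.range ι with hH
  have hHP : IsFace P' H := by
    rw [hH, hψ, ← Set.image_univ, himg, Set.image_univ, Subtype.range_coe]
    exact hF.mono hG.subset hFG
  have hmem : ∀ y : H, (ψ ⟨y.1, hHP.subset y.2⟩ : E') ∈ F := by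
    rintro ⟨-, -, ⟨y, rfl⟩, rfl⟩
    rw [Subtype.coe_eta, hι]
    exact y.2
  let χ : F ≃ₜ H :=
    { toFun := fun y => ⟨ι y, ⟨ι y, ⟨y, rfl⟩, rfl⟩⟩
      invFun := fun y => ⟨_, hmem y⟩
      left_inv := fun y => Subtype.ext (hι y)
      right_inv := fun y => Subtype.ext (by simp [ι])
      continuous_toFun := by fun_prop
      continuous_invFun := by fun_prop }
  refine ⟨fun x => ι (φ x), ⟨H, hHP, φ.trans χ, fun S => ?_, fun _ => rfl⟩, fun x => ?_⟩
  · have e1 : ((↑) '' ((φ.trans χ) '' S) : Set E'') = (↑) '' (ι '' (φ '' S)) := by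
      simp only [Set.image_image]
      rfl
    have s1 : ((↑) '' (φ '' S) : Set E') ⊆ F := by
      rintro _ ⟨y, -, rfl⟩; exact y.2
    have s2 : ((↑) '' (ι '' (φ '' S)) : Set E'') ⊆ H :=
      Set.image_mono (Set.image_subset_range _ _)
    rw [hφ S, e1]
    constructor
    · intro h
      refine IsFace.mono ?_ hHP.subset s2
      rw [hψ, himg]
      exact (hF.trans hQ h).mono hG.subset (s1.trans hFG)
    · intro h
      have := (hψ _).1 (hHP.trans hP' h)
      rw [himg] at this
      exact (hG.trans hQ this).mono hF.subset s1
  · exact Subtype.ext (by rw [hgψ, hfφ, hι])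

end FaceMaps

namespace IsAcyclicCategory

variable {C : Type*} [Category* C] {D : Type*} [Category* D]

lemma of_isoCat (hC : IsAcyclicCategory C) (e : IsoCat C D) : IsAcyclicCategory D where
  endo_eq_id x f := e.inverse.map_injective
    (by rw [hC.endo_eq_id _ (e.inverse.map f), e.inverse.map_id])
  eq_of_isIso x y f hf :=
    (e.inverse.bijective_obj).injective (hC.eq_of_isIso _ _ (e.inverse.map f) inferInstance)

end IsAcyclicCategory

instance CategoryTheory.Over.isIso_post {C : Type*} [Category* C] {D : Type*} [Category* D]
    (F : C ⥤ D) [F.IsIso] (x : C) : (Over.post (X := x) F).IsIso where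
  bijective_obj := by
    constructor
    · intro g g' h
      obtain ⟨y, g, rfl⟩ := g.exists_eq_mk
      obtain ⟨y', g', rfl⟩ := g'.exists_eq_mk
      obtain rfl : y = y' := F.bijective_obj.injective (congrArg Comma.left h)
      exact congrArg Over.mk (F.map_injective (Over.mk_injective h))
    · intro g
      obtain ⟨y, g, rfl⟩ := g.exists_eq_mk
      obtain ⟨y, rfl⟩ := F.bijective_obj.surjective y
      exact ⟨Over.mk (F.preimage g), by simp [Over.post]⟩

namespace PolyhedralCWComplex.FaceCategory

variable {K : Type u} [TopologicalSpace K] [T2Space K] {X : PolyhedralCWComplex K}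

lemma exists_factor {i j k : X.FaceCategory} (f : j ⟶ i) (g : k ⟶ i)
    (h : Set.range f.1 ⊆ Set.range g.1) : ∃ l : j ⟶ k, l ≫ g = f := by
  obtain ⟨l, hl, hlg⟩ := IsFaceMap.exists_factor (X.isPolytope _) (X.isPolytope _) f.2.1 g.2.1 h
  exact ⟨⟨l, hl, fun x => by rw [← g.2.2, hlg, f.2.2]⟩, Subtype.ext (funext hlg)⟩

variable (X) in
/-- The functor that sends a morphism of the face category to its image. -/
def overToFacePoset (i : X.FaceCategory) : Over i ⥤ FacePoset (X.cell i.index) where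
  obj g := ⟨(↑) '' Set.range g.hom.1, g.hom.2.1.isFace_range⟩
  map {g h} k := homOfLE <| Set.image_mono <| by
    rintro - ⟨x, rfl⟩
    exact ⟨k.left.1 x, congrFun (congrArg Subtype.val (Over.w k)) x⟩

/-- Injectivity of face maps gives faithfulness, factorization gives fullness, and (PC3) reaches
every face. Two morphisms with equal image factor through each other, so acyclicity identifies them.
-/
lemma isIso_overToFacePoset (hX : IsAcyclicCategory X.FaceCategory) (i : X.FaceCategory) :
    (overToFacePoset X i).IsIso where
  faithful := ⟨fun {g h} k k' _ => Over.OverMorphism.ext <| Subtype.ext <| funext fun x =>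
    h.hom.2.1.injective <| (congrFun (congrArg Subtype.val (Over.w k)) x).trans
      (congrFun (congrArg Subtype.val (Over.w k')) x).symm⟩
  full := ⟨fun {g h} k => by
    obtain ⟨l, hl⟩ := exists_factor g.hom h.hom
      ((Set.image_subset_image_iff Subtype.val_injective).1 (leOfHom k))
    exact ⟨Over.homMk l hl, Subsingleton.elim _ _⟩⟩
  bijective_obj := by
    constructor
    · intro g h e
      obtain ⟨j, g, rfl⟩ := g.exists_eq_mk
      obtain ⟨k, h, rfl⟩ := h.exists_eq_mk
      have e' : Set.range g.1 = Set.range h.1 :=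
        Subtype.val_injective.image_injective (congrArg Subtype.val e)
      obtain ⟨l, hl⟩ := exists_factor g h e'.subset
      obtain ⟨m, -⟩ := exists_factor h g e'.symm.subset
      obtain rfl := hX.eq_of_hom l m
      rw [← hl, hX.endo_eq_id _ l, Category.id_comp]
    · intro F
      obtain ⟨j, φ, hφ, hm⟩ := X.exists_face i.index F.1 F.2
      refine ⟨Over.mk (Y := (⟨j⟩ : X.FaceCategory)) ⟨fun x => ⟨φ x, F.2.subset (φ x).2⟩,
        ⟨F.1, F.2, φ, hφ, fun _ => rfl⟩, fun x => (hm x).symm⟩, Subtype.ext ?_⟩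
      exact image_range_eq_of_homeo φ fun _ => rfl

end PolyhedralCWComplex.FaceCategory

open PolyhedralCWComplex.FaceCategory in
theorem exists_isoCat_over_facePoset {C : Type u} [Category.{v} C] (hC : IsAcyclicCategory C)
    {K : Type u} [TopologicalSpace K] [T2Space K] {X : PolyhedralCWComplex K}
    (e : IsoCat C X.FaceCategory) (x : C) :
    ∃ (n : ℕ) (P : Set (EuclideanSpace ℝ (Fin n))), IsPolytope P ∧
      Nonempty (IsoCat (Over x) (FacePoset P)) := by
  have := isIso_overToFacePoset (hC.of_isoCat e) (e.functor.obj x)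
  exact ⟨_, _, X.isPolytope _, ⟨(Over.post (X := x) e.functor).asIsomorphism.trans
    (overToFacePoset X (e.functor.obj x)).asIsomorphism⟩⟩

theorem mainTheorem5 (C : Type u) [Category.{v} C] (hC : IsAcyclicCategory C) :
    (∃ (K : Type u) (_ : TopologicalSpace K) (_ : T2Space K) (X : PolyhedralCWComplex K),
      Nonempty (IsoCat C X.FaceCategory)) ↔
    ∀ x : C, ∃ (n : ℕ) (P : Set (EuclideanSpace ℝ (Fin n))), IsPolytope P ∧
      Nonempty (IsoCat (Over x) (FacePoset P)) :=
  ⟨fun ⟨_, _, _, _, ⟨e⟩⟩ x => exists_isoCat_over_facePoset hC e x,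
    exists_polyhedralCWComplex hC⟩
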